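/- Consider the system $x_{k+1}=Ax_k+Bu_k$, $y_k=Cx_k+Du_k$, $z_k=Ex_k+Fu_k$ with real matrices, $x_k\in\mathbb R^{n_x}$, $u_k\in\mathbb R^{n_u}$, $y_k\in\mathbb R^{n_y}$, $z_k\in\mathbb R^{n_z}$, a constraint set $\mathcal Y\subseteq\mathbb R^{n_y}$, a reference $r\in\mathbb R^{n_z}$, $\epsilon\in(0,1)$ and a horizon $N\ge 1$. Let the columns of $G=[G_x^T\;G_u^T\;G_z^T]^T$ be a basis of the kernel of $Z=\begin{bmatrix}A-I&B&0\\E&F&-I\end{bmatrix}$, and put $\bar x_v=G_xv$, $\bar u_v=G_uv$. Assume: 1. $(A,B)$ is stabilizable; 2. $G_z$ is square and invertible (one may normalize $G_z=I$, but this is not needed); 3. $\mathcal Y=\{y: Y_c\,y\le h\}$ is a compact polyhedron with $0\in\operatorname{int}\mathcal Y$; 4. $Q\succeq0$, $(A,Q)$ is detectable, $R\succ0$. Let $P\succeq 0$ be the solution of $P=Q+A^TPA-A^TPB(R+B^TPB)^{-1}B^TPA$, and let $K=(R+B^TPB)^{-1}B^TPA$. Let $\mathcal R_\epsilon=\{v:(CG_x+DG_u)v\in(1-\epsilon)\mathcal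 Y\}$. Let $\mathcal T$ be the set of all $(x,v)$ with $v\in\mathcal R_\epsilon$ such that the solution of $\xi_{i+1}=(A-BK)\xi_i+B(\bar u_v+K\bar x_v)$, $\xi_0=x$, satisfies $(C-DK)\xi_i+D(\bar u_v+K\bar x_v)\in\mathcal Y$ for all $i\ge0$. For $(x,v)$ consider the optimal control problem of minimizing $$\|\xi_N-\bar x_v\|_P^2+\sum_{i=0}^{N-1}\bigl(\|\xi_i-\bar x_v\|_Q^2+\|\mu_i-\bar u_v\|_R^2\bigr),\qquad \|a\|_M^2:=a^TMa,$$ over $\mu=(\mu_0,\dots,\mu_{N-1})$ subject to $\xi_0=x$, $\xi_{i+1}=A\xi_i+B\mu_i$ and $C\xi_i+D\mu_i\in\mathcal Y$ for $0\le i<N$, and $(\xi_N,v)\in\mathcal T$. Let $\Gamma_N$ be the set of $(x,v)$ for which it is feasible, let $\Lambda=\Gamma_N\cap(\mathbb R^{n_x}\times\mathcal R_\epsilon)$, and let $\Pi_x\Lambda$ be the projection of $\Lambda$ onto the $x$ coordinates. Then the optimal control problem has a unique minimizer $\mu^\star(x,v)$ for every $(x,v)\in\Gamma_N$; for every $x\in\Pi_x\Lambda$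 there is a unique $g(x,r)=\arg\min\{\|v-r\|_2^2: v\in\mathcal R_\epsilon,\ (x,v)\in\Gamma_N\}$; and $r$ has a unique Euclidean projection $r^\star$ onto $\mathcal R_\epsilon$. Moreover, for the closed loop $$v_k=g(x_k,r),\qquad x_{k+1}=Ax_k+B\,\mu_0^\star(x_k,v_k),$$ with state $(x_k,v_{k-1})$ at time $k$, the point $(G_xr^\star,r^\star)$ is an asymptotically stable equilibrium (it is an equilibrium, it is Lyapunov stable, and it attracts a neighbourhood of itself), and its domain of attraction, that is, the set of initial states $(x_0,v_{-1})$ from which the closed loop is defined for all time and $(x_k,v_{k-1})\to(G_xr^\star,r^\star)$, is exactly $\Pi_x\Lambda\times\mathbb R^{n_z}$. -/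

import Mathlib

open Matrix Set Filter Topology
open scoped Pointwise

namespace FeasGov

/-! ### Discrete-time dynamics given by a (possibly partially defined) transition relation -/

section Dynamics

variable {α : Type*}

/-- An infinite trajectory of the transition relation `step`. -/
def IsTrajectory (step : α → α → Prop) (p : ℕ → α) : Prop :=
  ∀ k, step (p k) (p (k + 1))

/-- `e` is an equilibrium: its one and only successor is `e` itself. -/
def IsEquilibrium (step : α → α → Prop) (e : α) : Prop :=
  ∀ q, step e q ↔ q = e

variable [TopologicalSpace α]

/-- Lyapunov stability: all states close enough to `e` have a trajectory, and the trajectories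
starting from them stay in a prescribed neighbourhood of `e` for all time. -/
def IsLyapunovStable (step : α → α → Prop) (e : α) : Prop :=
  ∀ U ∈ 𝓝 e, ∃ W ∈ 𝓝 e, ∀ a ∈ W,
    (∃ p, IsTrajectory step p ∧ p 0 = a) ∧
      ∀ p, IsTrajectory step p → p 0 = a → ∀ k, p k ∈ U

/-- The domain of attraction of `e`: the initial states from which the dynamics can be run for all
time and from which every trajectory converges to `e`. -/
def domainOfAttraction (step : α → α → Prop) (e : α) : Set α :=
  {a | (∃ p, IsTrajectory step p ∧ p 0 = a) ∧
    ∀ p, IsTrajectory step p → p 0 = a → Tendsto p atTop (𝓝 e)}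

/-- Asymptotically stable equilibrium: an equilibrium that is Lyapunov stable and attracts a
neighbourhood of itself. -/
def IsAsymptoticallyStable (step : α → α → Prop) (e : α) : Prop :=
  IsEquilibrium step e ∧ IsLyapunovStable step e ∧ domainOfAttraction step e ∈ 𝓝 e

end Dynamics

/-! ### Matrix notions -/

/-- Schur stability: all complex eigenvalues lie in the open unit disk. -/
def IsSchur {n : ℕ} (M : Matrix (Fin n) (Fin n) ℝ) : Prop :=
  ∀ z ∈ spectrum ℂ (M.map (algebraMap ℝ ℂ)), ‖z‖ < 1

/-- `(A, B)` is stabilizable. -/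
def Stabilizable {n m : ℕ} (A : Matrix (Fin n) (Fin n) ℝ) (B : Matrix (Fin n) (Fin m) ℝ) : Prop :=
  ∃ F : Matrix (Fin m) (Fin n) ℝ, IsSchur (A - B * F)

/-- `(A, Q)` is detectable. -/
def Detectable {n m : ℕ} (A : Matrix (Fin n) (Fin n) ℝ) (Q : Matrix (Fin m) (Fin n) ℝ) : Prop :=
  ∃ L : Matrix (Fin n) (Fin m) ℝ, IsSchur (A - L * Q)

/-- The squared weighted norm `‖x‖_M ^ 2 = xᵀ M x`. -/
def wsq {n : ℕ} (M : Matrix (Fin n) (Fin n) ℝ) (x : Fin n → ℝ) : ℝ := x ⬝ᵥ (M *ᵥ x)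

/-- The squared Euclidean norm `‖x‖₂ ^ 2 = xᵀ x`. -/
def nsq {n : ℕ} (x : Fin n → ℝ) : ℝ := x ⬝ᵥ x

/-! ### The system, the model predictive controller and the feasibility governor -/

/-- The raw data: system matrices, a parametrization `(Gx, Gu, Gz)` of the equilibria, the constraint
polyhedron `{y | Yc y ≤ h}`, the tightening `ε`, the prediction horizon and the cost weights. -/
structure Data (nx nu ny nz nc : ℕ) where
  A : Matrix (Fin nx) (Fin nx) ℝ
  B : Matrix (Fin nx) (Fin nu) ℝ
  C : Matrix (Fin ny) (Fin nx) ℝ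
  D : Matrix (Fin ny) (Fin nu) ℝ
  E : Matrix (Fin nz) (Fin nx) ℝ
  F : Matrix (Fin nz) (Fin nu) ℝ
  Gx : Matrix (Fin nx) (Fin nz) ℝ
  Gu : Matrix (Fin nu) (Fin nz) ℝ
  Gz : Matrix (Fin nz) (Fin nz) ℝ
  Yc : Matrix (Fin nc) (Fin ny) ℝ
  h : Fin nc → ℝ
  ε : ℝ
  N : ℕ
  N_pos : 0 < N
  Q : Matrix (Fin nx) (Fin nx) ℝ
  R : Matrix (Fin nu) (Fin nu) ℝ
  P : Matrix (Fin nx) (Fin nx) ℝ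

namespace Data

variable {nx nu ny nz nc : ℕ} (S : Data nx nu ny nz nc)

/-- The matrix `Z = [A - I, B, 0; E, F, -I]`, whose kernel consists of the equilibria `(x, u, z)`. -/
def Z : Matrix (Fin nx ⊕ Fin nz) (Fin nx ⊕ (Fin nu ⊕ Fin nz)) ℝ :=
  fromBlocks (S.A - 1) (fromCols S.B 0) S.E (fromCols S.F (-1))

/-- The matrix `G`, with block rows `Gx`, `Gu`, `Gz`. -/
def G : Matrix (Fin nx ⊕ (Fin nu ⊕ Fin nz)) (Fin nz) ℝ :=
  fromRows S.Gx (fromRows S.Gu S.Gz)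

/-- The columns of `G` form a basis of `ker Z`. -/
def IsEquilibriumBasis : Prop :=
  LinearIndependent ℝ S.G.col ∧ Submodule.span ℝ (range S.G.col) = LinearMap.ker S.Z.mulVecLin

/-- The constraint set. -/
def Y : Set (Fin ny → ℝ) := {y | S.Yc *ᵥ y ≤ S.h}

/-- The strictly steady-state admissible references. -/
def Reps : Set (Fin nz → ℝ) := {v | (S.C * S.Gx + S.D * S.Gu) *ᵥ v ∈ (1 - S.ε) • S.Y}

/-- The LQR gain. -/
noncomputable def K : Matrix (Fin nu) (Fin nx) ℝ :=
  (S.R + S.Bᵀ * S.P * S.B)⁻¹ * (S.Bᵀ * S.P * S.A)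

/-- `P` is the positive semidefinite solution of the discrete algebraic Riccati equation. -/
def IsRiccatiSolution : Prop :=
  S.P.PosSemidef ∧
    S.P = S.Q + S.Aᵀ * S.P * S.A
      - (S.Aᵀ * S.P * S.B) * (S.R + S.Bᵀ * S.P * S.B)⁻¹ * (S.Bᵀ * S.P * S.A)

/-- One step of the system under the terminal law `u = ū_v - K (x - x̄_v)`. -/
noncomputable def termStep (v : Fin nz → ℝ) (x : Fin nx → ℝ) : Fin nx → ℝ :=
  (S.A - S.B * S.K) *ᵥ x + S.B *ᵥ (S.Gu *ᵥ v + S.K *ᵥ (S.Gx *ᵥ v))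

/-- The constrained output under the terminal law. -/
noncomputable def termOut (v : Fin nz → ℝ) (x : Fin nx → ℝ) : Fin ny → ℝ :=
  (S.C - S.D * S.K) *ᵥ x + S.D *ᵥ (S.Gu *ᵥ v + S.K *ᵥ (S.Gx *ᵥ v))

/-- The terminal set: the maximal output admissible set of the system under the terminal law with
constant reference `v`, with the steady-state constraint tightened by the factor `1 - ε`. -/
def T : Set ((Fin nx → ℝ) × (Fin nz → ℝ)) :=
  {p | p.2 ∈ S.Reps ∧ ∀ i : ℕ, S.termOut p.2 ((S.termStep p.2)^[i] p.1) ∈ S.Y}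

/-- The predicted states `ξ_i`, for `i ≤ N`, under the input sequence `μ` (extended by zero to
`i ≥ N`, where it is not used). -/
def pred (x : Fin nx → ℝ) (μ : Fin S.N → Fin nu → ℝ) : ℕ → Fin nx → ℝ
  | 0 => x
  | i + 1 => S.A *ᵥ pred x μ i + S.B *ᵥ (if hi : i < S.N then μ ⟨i, hi⟩ else 0)

/-- The constraints of the optimal control problem. -/
def OCPFeasible (x : Fin nx → ℝ) (v : Fin nz → ℝ) (μ : Fin S.N → Fin nu → ℝ) : Prop :=
  (∀ i : Fin S.N, S.C *ᵥ S.pred x μ i + S.D *ᵥ μ i ∈ S.Y) ∧ (S.pred x μ S.N, v) ∈ S.T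

/-- The cost of the optimal control problem. -/
def OCPCost (x : Fin nx → ℝ) (v : Fin nz → ℝ) (μ : Fin S.N → Fin nu → ℝ) : ℝ :=
  wsq S.P (S.pred x μ S.N - S.Gx *ᵥ v) +
    ∑ i : Fin S.N, (wsq S.Q (S.pred x μ i - S.Gx *ᵥ v) + wsq S.R (μ i - S.Gu *ᵥ v))

/-- `μ` is a minimizer of the optimal control problem. -/
def IsOCPMinimizer (x : Fin nx → ℝ) (v : Fin nz → ℝ) (μ : Fin S.N → Fin nu → ℝ) : Prop :=
  S.OCPFeasible x v μ ∧ ∀ ν, S.OCPFeasible x v ν → S.OCPCost x v μ ≤ S.OCPCost x v ν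

/-- The feasible set of the optimal control problem. -/
def Γ : Set ((Fin nx → ℝ) × (Fin nz → ℝ)) := {p | ∃ μ, S.OCPFeasible p.1 p.2 μ}

/-- The feasible set of the governor. -/
def Λ : Set ((Fin nx → ℝ) × (Fin nz → ℝ)) := S.Γ ∩ (univ ×ˢ S.Reps)

/-- `v` is a Euclidean projection of `r` onto `Reps`. -/
def IsProjection (r v : Fin nz → ℝ) : Prop :=
  v ∈ S.Reps ∧ ∀ w ∈ S.Reps, nsq (v - r) ≤ nsq (w - r)

/-- `v` is an output `g(x, r)` of the governor: a point of `Reps` closest to `r` among those for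
which the optimal control problem at `x` is feasible. -/
def IsGovernorOutput (r : Fin nz → ℝ) (x : Fin nx → ℝ) (v : Fin nz → ℝ) : Prop :=
  (v ∈ S.Reps ∧ (x, v) ∈ S.Γ) ∧ ∀ w ∈ S.Reps, (x, w) ∈ S.Γ → nsq (v - r) ≤ nsq (w - r)

/-- The closed loop. The state at time `k` is `(x_k, v_{k-1})`, and the successor of `(x, w)` is
`(x⁺, v)` with `v = g(x, r)` and `x⁺ = A x + B κ(x, v)`, where `κ(x, v)` is the first entry of the
minimizer of the optimal control problem. There is no successor where these are undefined. -/
def ClosedLoop (r : Fin nz → ℝ) (p q : (Fin nx → ℝ) × (Fin nz → ℝ)) : Prop :=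
  S.IsGovernorOutput r p.1 q.2 ∧
    ∃ μ, S.IsOCPMinimizer p.1 q.2 μ ∧ q.1 = S.A *ᵥ p.1 + S.B *ᵥ μ ⟨0, S.N_pos⟩

end Data

end FeasGov

/-!
Completing squares in the Riccati equation writes the cost of an input sequence as `‖x - x̄_v‖²_P`
plus a weighted sum of squared deviations of the inputs from the terminal law. As `P` may be
singular, the optimal cost need not control the tracking error; only the deviation cost is
followed along the closed loop. Shifting a plan by one step removes its first deviation, and since
the feasible plans form a polyhedron (the terminal set is determined by finitely many outputs),
Hoffman's lemma bounds the effect of a change of the reference by the square of that change.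
Adding a multiple of the deviation cost to the square of a norm contracted by `A - BK` gives a
function that decreases geometrically up to the squared change of the reference. The governor
projects `r` onto convex sets that contain the previous reference, so these squares are summable
and the tracking error tends to zero. Once it is small, every admissible reference close to the
current one is feasible, so the governor's output minimizes the distance to `r` locally, hence
globally, on `R_ε`, and equals `r*`. Inside the terminal set with reference `r*` the closed loop
is the terminal law, whose error dynamics are Schur stable.
-/

namespace FeasGov

/-! ### Polyhedra -/

section Polyhedra

section Basic

variable {E F : Type*} [AddCommGroup E] [Module ℝ E] [TopologicalSpace E]
  [AddCommGroup F] [Module ℝ F] [TopologicalSpace F]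

/-- A polyhedron: the solution set of finitely many affine inequalities, encoded by the finite set
of pairs (linear functional, bound). -/
def IsPolyhedral (s : Set E) : Prop :=
  ∃ a : Set ((E →L[ℝ] ℝ) × ℝ), a.Finite ∧ s = {x | ∀ p ∈ a, p.1 x ≤ p.2}

theorem isPolyhedral_iInter {ι : Type*} [Finite ι] {s : ι → Set E}
    (hs : ∀ i, IsPolyhedral (s i)) : IsPolyhedral (⋂ i, s i) := by
  choose a ha hs using hs
  refine ⟨⋃ i, a i, finite_iUnion ha, ?_⟩
  ext x
  simp only [hs, mem_iInter, mem_ofPred_eq, mem_iUnion, forall_exists_index]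
  exact forall_comm

theorem IsPolyhedral.inter {s t : Set E} (hs : IsPolyhedral s) (ht : IsPolyhedral t) :
    IsPolyhedral (s ∩ t) := by
  rw [inter_eq_iInter]
  exact isPolyhedral_iInter (Bool.forall_bool.2 ⟨ht, hs⟩)

theorem IsPolyhedral.preimage {s : Set F} (hs : IsPolyhedral s) (f : E →L[ℝ] F) :
    IsPolyhedral (f ⁻¹' s) := by
  obtain ⟨a, ha, rfl⟩ := hs
  refine ⟨(fun p => (p.1.comp f, p.2)) '' a, ha.image _, ?_⟩
  ext x
  simp only [mem_preimage, mem_ofPred_eq, forall_mem_image, ContinuousLinearMap.comp_apply]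

theorem IsPolyhedral.isClosed {s : Set E} (hs : IsPolyhedral s) : IsClosed s := by
  obtain ⟨a, -, rfl⟩ := hs
  simp only [ofPred_forall]
  exact isClosed_biInter fun p _ => isClosed_le p.1.continuous continuous_const

theorem IsPolyhedral.convex {s : Set E} (hs : IsPolyhedral s) : Convex ℝ s := by
  obtain ⟨a, -, rfl⟩ := hs
  simp only [ofPred_forall]
  exact convex_iInter₂ fun p _ => convex_halfSpace_le p.1.toLinearMap.isLinear _

end Basic

theorem mem_add_submodule {E : Type*} [AddCommGroup E] [Module ℝ E] {s : Set E}
    {V : Submodule ℝ E} {y : E} : y ∈ s + (V : Set E) ↔ ∃ w ∈ V, y + w ∈ s := by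
  constructor
  · rintro ⟨x, hx, w, hw, rfl⟩
    exact ⟨-w, V.neg_mem hw, by simpa using hx⟩
  · rintro ⟨w, hw, hyw⟩
    exact ⟨y + w, hyw, -w, V.neg_mem hw, by simp⟩

theorem mem_add_span_singleton {E : Type*} [AddCommGroup E] [Module ℝ E] {s : Set E} {d y : E} :
    y ∈ s + (Submodule.span ℝ {d} : Set E) ↔ ∃ t : ℝ, y + t • d ∈ s := by
  simp only [mem_add_submodule, Submodule.mem_span_singleton, exists_exists_eq_and]

theorem exists_between_of_finite {α : Type*} [LinearOrder α] [Nonempty α] {lo hi : Set α}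
    (hlo : lo.Finite) (hhi : hi.Finite) (h : ∀ a ∈ lo, ∀ b ∈ hi, a ≤ b) :
    ∃ t, (∀ a ∈ lo, a ≤ t) ∧ ∀ b ∈ hi, t ≤ b := by
  rcases lo.eq_empty_or_nonempty with rfl | hne
  · obtain ⟨t, ht⟩ := hhi.bddBelow
    exact ⟨t, by simp, fun b hb => ht hb⟩
  · obtain ⟨t, ht, hmax⟩ := exists_max_image lo id hlo hne
    exact ⟨t, hmax, fun b hb => h t ht b hb⟩

theorem exists_forall_mul_le {a : Set (ℝ × ℝ)} (ha : a.Finite)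
    (h_zero : ∀ p ∈ a, p.1 = 0 → 0 ≤ p.2)
    (h_cross : ∀ p ∈ a, ∀ q ∈ a, 0 < p.1 → q.1 < 0 → q.1 * p.2 ≤ p.1 * q.2) :
    ∃ t : ℝ, ∀ p ∈ a, t * p.1 ≤ p.2 := by
  obtain ⟨t, h_lower, h_upper⟩ := exists_between_of_finite
    (lo := (fun q : ℝ × ℝ => q.2 / q.1) '' {q ∈ a | q.1 < 0})
    (hi := (fun p : ℝ × ℝ => p.2 / p.1) '' {p ∈ a | 0 < p.1})
    ((ha.sep _).image _) ((ha.sep _).image _) (by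
      rintro _ ⟨q, ⟨hq, hq_neg⟩, rfl⟩ _ ⟨p, ⟨hp, hp_pos⟩, rfl⟩
      rw [div_le_iff_of_neg hq_neg, div_mul_eq_mul_div, div_le_iff₀ hp_pos]
      linarith [h_cross p hp q hq hp_pos hq_neg])
  refine ⟨t, fun p hp => ?_⟩
  rcases lt_trichotomy p.1 0 with h | h | h
  · exact (div_le_iff_of_neg h).1 (h_lower _ (mem_image_of_mem _ ⟨hp, h⟩))
  · simpa [h] using h_zero p hp h
  · exact (le_div_iff₀ h).1 (h_upper _ (mem_image_of_mem _ ⟨hp, h⟩))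

-- Fourier-Motzkin elimination of the direction `d`.
theorem IsPolyhedral.add_span_singleton {E : Type*} [AddCommGroup E] [Module ℝ E]
    [TopologicalSpace E] {s : Set E} (hs : IsPolyhedral s) (d : E) :
    IsPolyhedral (s + (Submodule.span ℝ {d} : Set E)) := by
  obtain ⟨a, ha, rfl⟩ := hs
  refine ⟨{p ∈ a | p.1 d = 0} ∪ image2 (fun p q => ((-(q.1 d)) • p.1 + (p.1 d) • q.1,
    (-(q.1 d)) * p.2 + (p.1 d) * q.2)) {p ∈ a | 0 < p.1 d} {p ∈ a | p.1 d < 0},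
    (ha.sep _).union ((ha.sep _).image2 _ (ha.sep _)), ?_⟩
  ext y
  simp only [mem_add_span_singleton, mem_ofPred_eq, map_add, map_smul, smul_eq_mul]
  constructor
  · rintro ⟨t, ht⟩ p (⟨hp, hp_zero⟩ | ⟨p, ⟨hp, hp_pos⟩, q, ⟨hq, hq_neg⟩, rfl⟩)
    · simpa [hp_zero] using ht p hp
    · simp only [_root_.add_apply, _root_.smul_apply, smul_eq_mul]
      nlinarith [ht p hp, ht q hq]
  · intro h
    obtain ⟨t, ht⟩ := exists_forall_mul_le
      (ha.image fun p : (E →L[ℝ] ℝ) × ℝ => (p.1 d, p.2 - p.1 y))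
      (by
        rintro _ ⟨p, hp, rfl⟩ hp_zero
        exact sub_nonneg.2 (h p (Or.inl ⟨hp, hp_zero⟩)))
      (by
        rintro _ ⟨p, hp, rfl⟩ _ ⟨q, hq, rfl⟩ hp_pos hq_neg
        have := h _ (Or.inr ⟨p, ⟨hp, hp_pos⟩, q, ⟨hq, hq_neg⟩, rfl⟩)
        simp only [_root_.add_apply, _root_.smul_apply, smul_eq_mul] at this
        linarith)
    exact ⟨t, fun p hp => le_sub_iff_add_le'.1 (ht _ (mem_image_of_mem _ hp))⟩

theorem IsPolyhedral.add_submodule {E : Type*} [AddCommGroup E] [Module ℝ E]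
    [TopologicalSpace E] {V : Submodule ℝ E} (hV : V.FG) {s : Set E} (hs : IsPolyhedral s) :
    IsPolyhedral (s + (V : Set E)) := by
  induction V, hV using Submodule.fg_induction generalizing s with
  | singleton d => exact hs.add_span_singleton d
  | sup V W _ _ ihV ihW =>
    rw [Submodule.coe_sup, ← add_assoc]
    exact ihW (ihV hs)

variable {E F : Type*} [NormedAddCommGroup E] [NormedSpace ℝ E]
  [NormedAddCommGroup F] [NormedSpace ℝ F]

/-- The slices of `s` parallel to `V` depend on the base point in a Lipschitz way: a point `x` of
`s` can be moved into the slice through `y` at a cost proportional to the distance from `x` to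
`y`. -/
def HasLipschitzSlices (s : Set E) (V : Submodule ℝ E) : Prop :=
  ∃ L : ℝ, 0 ≤ L ∧ ∀ x ∈ s, ∀ y ∈ s + (V : Set E), ∃ z ∈ s, z - y ∈ V ∧ ‖z - x‖ ≤ L * ‖y - x‖

theorem HasLipschitzSlices.sup {s : Set E} {V W : Submodule ℝ E} (hV : HasLipschitzSlices s V)
    (hW : HasLipschitzSlices (s + (V : Set E)) W) : HasLipschitzSlices s (V ⊔ W) := by
  obtain ⟨L, hL, hs⟩ := hV
  obtain ⟨M, hM, hsV⟩ := hW
  refine ⟨L * M, by positivity, fun x hx y hy => ?_⟩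
  rw [Submodule.coe_sup, ← add_assoc] at hy
  obtain ⟨y', hy', hy'W, hy'x⟩ := hsV x ⟨x, hx, 0, V.zero_mem, add_zero x⟩ y hy
  obtain ⟨z, hz, hzV, hzx⟩ := hs x hx y' hy'
  refine ⟨z, hz, ?_, ?_⟩
  · rw [← sub_add_sub_cancel z y' y]
    exact Submodule.add_mem_sup hzV hy'W
  · calc ‖z - x‖ ≤ L * ‖y' - x‖ := hzx
      _ ≤ L * (M * ‖y - x‖) := by gcongr
      _ = L * M * ‖y - x‖ := by ring

theorem exists_forall_mul_le_abs_le {a : Set (ℝ × ℝ)} (ha : a.Finite) {t₀ κ : ℝ}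
    (ht₀ : ∀ p ∈ a, t₀ * p.1 ≤ p.2) (hκ : 0 ≤ κ) (h : ∀ p ∈ a, -p.2 ≤ |p.1| * κ) :
    ∃ t : ℝ, (∀ p ∈ a, t * p.1 ≤ p.2) ∧ |t| ≤ κ := by
  obtain ⟨t, ht⟩ := exists_forall_mul_le (a := a ∪ {(1, κ), (-1, κ)}) (ha.union (by simp))
    (by
      rintro p (hp | rfl | rfl) hp_zero
      · simpa [hp_zero] using ht₀ p hp
      all_goals norm_num at hp_zero)
    (by
      rintro p (hp | rfl | rfl) q (hq | rfl | rfl) hp_pos hq_neg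
      · nlinarith [ht₀ p hp, ht₀ q hq]
      · norm_num at hq_neg
      · have := h p hp
        rw [abs_of_pos hp_pos] at this
        linarith
      · have := h q hq
        rw [abs_of_neg hq_neg] at this
        linarith
      · norm_num at hq_neg
      · linarith
      all_goals norm_num at hp_pos)
  refine ⟨t, fun p hp => ht p (Or.inl hp), abs_le'.2 ⟨?_, ?_⟩⟩
  · simpa using ht (1, κ) (by simp)
  · simpa using ht (-1, κ) (by simp)

theorem IsPolyhedral.hasLipschitzSlices_span_singleton {s : Set E} (hs : IsPolyhedral s) (d : E) :
    HasLipschitzSlices s (Submodule.span ℝ {d}) := by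
  obtain ⟨a, ha, rfl⟩ := hs
  obtain ⟨c, hc⟩ : ∃ c : ℝ, ∀ p ∈ a, ‖p.1‖ / |p.1 d| ≤ c := by
    obtain ⟨c, hc⟩ := (ha.image fun p => ‖p.1‖ / |p.1 d|).bddAbove
    exact ⟨c, fun p hp => hc (mem_image_of_mem _ hp)⟩
  refine ⟨1 + max c 0 * ‖d‖, by positivity, fun x hx y hy => ?_⟩
  obtain ⟨t₀, ht₀⟩ := mem_add_span_singleton.1 hy
  have h_feas : ∀ p ∈ a, t₀ * p.1 d ≤ p.2 - p.1 y := fun p hp =>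
    le_sub_iff_add_le'.2 (by simpa using ht₀ p hp)
  have h_viol : ∀ p ∈ a, -(p.2 - p.1 y) ≤ |p.1 d| * (max c 0 * ‖y - x‖) := by
    intro p hp
    rcases eq_or_ne (p.1 d) 0 with hpd | hpd
    · simpa [hpd] using h_feas p hp
    · calc -(p.2 - p.1 y) ≤ p.1 (y - x) := by rw [map_sub]; linarith [hx p hp]
        _ ≤ ‖p.1‖ * ‖y - x‖ := (le_abs_self _).trans (p.1.le_opNorm _)
        _ ≤ (max c 0 * |p.1 d|) * ‖y - x‖ := by
          gcongr
          exact (div_le_iff₀ (abs_pos.2 hpd)).1 ((hc p hp).trans (le_max_left _ _))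
        _ = |p.1 d| * (max c 0 * ‖y - x‖) := by ring
  obtain ⟨t, ht, ht_abs⟩ := exists_forall_mul_le_abs_le
    (ha.image fun p : (E →L[ℝ] ℝ) × ℝ => (p.1 d, p.2 - p.1 y)) (forall_mem_image.2 h_feas)
    (by positivity) (forall_mem_image.2 h_viol)
  refine ⟨y + t • d, fun p hp => ?_, ?_, ?_⟩
  · simpa using le_sub_iff_add_le'.1 (ht _ (mem_image_of_mem _ hp))
  · simpa using Submodule.smul_mem _ t (Submodule.mem_span_singleton_self d)
  · calc ‖y + t • d - x‖ = ‖(y - x) + t • d‖ := by rw [add_sub_right_comm]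
      _ ≤ ‖y - x‖ + |t| * ‖d‖ := by
        simpa only [norm_smul, Real.norm_eq_abs] using norm_add_le (y - x) (t • d)
      _ ≤ ‖y - x‖ + (max c 0 * ‖y - x‖) * ‖d‖ := by gcongr
      _ = (1 + max c 0 * ‖d‖) * ‖y - x‖ := by ring

-- Hoffman's lemma.
theorem IsPolyhedral.hasLipschitzSlices {V : Submodule ℝ E} (hV : V.FG) {s : Set E}
    (hs : IsPolyhedral s) : HasLipschitzSlices s V := by
  induction V, hV using Submodule.fg_induction generalizing s with
  | singleton d => exact hs.hasLipschitzSlices_span_singleton d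
  | sup V W hV _ ihV ihW => exact (ihV hs).sup (ihW (hs.add_submodule hV))

theorem mem_add_range_inr {s : Set (E × F)} {a : E} {b : F} :
    (a, b) ∈ s + (LinearMap.range (LinearMap.inr ℝ E F) : Set (E × F)) ↔ ∃ b', (a, b') ∈ s := by
  rw [mem_add_submodule]
  constructor
  · rintro ⟨_, ⟨c, rfl⟩, h⟩
    exact ⟨b + c, by simpa using h⟩
  · rintro ⟨b', h⟩
    exact ⟨_, ⟨b' - b, rfl⟩, by simpa using h⟩

theorem fg_range_inr [FiniteDimensional ℝ F] : (LinearMap.range (LinearMap.inr ℝ E F)).FG :=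
  Module.Finite.iff_fg.1 (Module.Finite.range _)

theorem IsPolyhedral.image_fst [FiniteDimensional ℝ F] {s : Set (E × F)} (hs : IsPolyhedral s) :
    IsPolyhedral (Prod.fst '' s) := by
  convert (hs.add_submodule fg_range_inr).preimage (ContinuousLinearMap.inl ℝ E F)
  ext a
  simp [mem_add_range_inr]

theorem IsPolyhedral.exists_lipschitz_fibers [FiniteDimensional ℝ F] {s : Set (E × F)}
    (hs : IsPolyhedral s) :
    ∃ L : ℝ, 0 ≤ L ∧ ∀ a b, (a, b) ∈ s → ∀ a' ∈ Prod.fst '' s,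
      ∃ b', (a', b') ∈ s ∧ ‖b' - b‖ ≤ L * ‖a' - a‖ := by
  obtain ⟨L, hL, h⟩ := hs.hasLipschitzSlices fg_range_inr
  refine ⟨L, hL, fun a b hab a' ha' => ?_⟩
  obtain ⟨⟨a', b'⟩, hab', rfl⟩ := ha'
  obtain ⟨z, hz, ⟨c, hc⟩, hzL⟩ := h (a, b) hab (a', b) (mem_add_range_inr.2 ⟨b', hab'⟩)
  obtain rfl : z = (a', b + c) := by
    rw [← sub_add_cancel z (a', b), ← hc]
    simp [add_comm]
  refine ⟨b + c, hz, (norm_snd_le ((a', b + c) - (a, b))).trans ?_⟩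
  simpa using hzL

end Polyhedra

/-! ### Quadratic forms and strictly convex minimization -/

section Homogeneous

variable {E : Type*} [NormedAddCommGroup E] [NormedSpace ℝ E] {f : E → ℝ}

theorem eq_sq_norm_mul_of_homogeneous (hf : ∀ (c : ℝ) x, f (c • x) = c ^ 2 * f x) {x : E}
    (hx : x ≠ 0) : f x = ‖x‖ ^ 2 * f (‖x‖⁻¹ • x) := by
  rw [← hf, smul_inv_smul₀ (norm_ne_zero_iff.2 hx)]

theorem map_zero_of_homogeneous (hf : ∀ (c : ℝ) x, f (c • x) = c ^ 2 * f x) : f 0 = 0 := by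
  simpa using hf 0 0

theorem inv_norm_smul_mem_sphere {x : E} (hx : x ≠ 0) : ‖x‖⁻¹ • x ∈ Metric.sphere (0 : E) 1 := by
  simp [norm_smul, norm_ne_zero_iff.2 hx]

variable [FiniteDimensional ℝ E]

theorem exists_le_mul_sq_norm_of_homogeneous (hf : Continuous f)
    (hf_smul : ∀ (c : ℝ) x, f (c • x) = c ^ 2 * f x) :
    ∃ C : ℝ, 0 ≤ C ∧ ∀ x, f x ≤ C * ‖x‖ ^ 2 := by
  obtain ⟨C, hC⟩ := (isCompact_sphere (0 : E) 1).bddAbove_image hf.continuousOn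
  refine ⟨max C 0, le_max_right _ _, fun x => ?_⟩
  rcases eq_or_ne x 0 with rfl | hx
  · simp [map_zero_of_homogeneous hf_smul]
  · rw [eq_sq_norm_mul_of_homogeneous hf_smul hx, mul_comm]
    gcongr
    exact (hC (mem_image_of_mem f (inv_norm_smul_mem_sphere hx))).trans (le_max_left _ _)

theorem exists_mul_sq_norm_le_of_homogeneous (hf : Continuous f)
    (hf_smul : ∀ (c : ℝ) x, f (c • x) = c ^ 2 * f x) (hf_pos : ∀ x ≠ 0, 0 < f x) :
    ∃ c : ℝ, 0 < c ∧ ∀ x, c * ‖x‖ ^ 2 ≤ f x := by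
  rcases subsingleton_or_nontrivial E with hE | hE
  · refine ⟨1, one_pos, fun x => ?_⟩
    simp [Subsingleton.elim x 0, map_zero_of_homogeneous hf_smul]
  · obtain ⟨x₀, hx₀, hmin⟩ := (isCompact_sphere (0 : E) 1).exists_isMinOn
      (NormedSpace.sphere_nonempty.2 zero_le_one) hf.continuousOn
    refine ⟨f x₀, hf_pos _ (ne_zero_of_mem_unit_sphere ⟨x₀, hx₀⟩), fun x => ?_⟩
    rcases eq_or_ne x 0 with rfl | hx
    · simp [map_zero_of_homogeneous hf_smul]
    · rw [eq_sq_norm_mul_of_homogeneous hf_smul hx, mul_comm]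
      gcongr
      exact hmin (inv_norm_smul_mem_sphere hx)

end Homogeneous

section StrictConvex

theorem strictConvexOn_of_defect {E : Type*} [AddCommGroup E] [Module ℝ E] {f g : E → ℝ}
    (hf : ∀ x y a b, a + b = 1 → f (a • x + b • y) = a * f x + b * f y - a * b * g (x - y))
    (hg : ∀ x ≠ 0, 0 < g x) : StrictConvexOn ℝ univ f := by
  refine ⟨convex_univ, fun x _ y _ hxy a b ha hb hab => ?_⟩
  rw [hf x y a b hab, smul_eq_mul, smul_eq_mul]
  exact sub_lt_self _ (mul_pos (mul_pos ha hb) (hg _ (sub_ne_zero.2 hxy)))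

theorem existsUnique_isMinOn {E : Type*} [AddCommGroup E] [Module ℝ E] [TopologicalSpace E]
    {s : Set E} {f : E → ℝ} (hs : IsClosed s) (hs_ne : s.Nonempty) (hf : ContinuousOn f s)
    (hf_conv : StrictConvexOn ℝ s f) (hf_top : Tendsto f (cocompact E) atTop) :
    ∃! x, x ∈ s ∧ IsMinOn f s x := by
  obtain ⟨z, hz⟩ := hs_ne
  obtain ⟨x, hx, hmin⟩ := hf.exists_isMinOn' hs hz
    ((hf_top.eventually_ge_atTop (f z)).filter_mono inf_le_left)
  exact ⟨x, ⟨hx, hmin⟩, fun y ⟨hy, hy_min⟩ => hf_conv.eq_of_isMinOn hy_min hmin hy hx⟩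

theorem tendsto_cocompact_atTop_of_mul_sq_norm_le {E : Type*} [NormedAddCommGroup E]
    [ProperSpace E] {f : E → ℝ} {c : ℝ} (hc : 0 < c) {x₀ : E}
    (hf : ∀ x, c * ‖x - x₀‖ ^ 2 ≤ f x) : Tendsto f (cocompact E) atTop := by
  refine tendsto_atTop_mono hf (Tendsto.const_mul_atTop hc ?_)
  exact (tendsto_pow_atTop two_ne_zero).comp ((tendsto_norm_cocompact_atTop (E := E)).comp
    (Homeomorph.subRight x₀).isClosedEmbedding.tendsto_cocompact)

end StrictConvex

section WeightedSquare

variable {n : ℕ} {M : Matrix (Fin n) (Fin n) ℝ}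

theorem continuous_wsq (M : Matrix (Fin n) (Fin n) ℝ) : Continuous (wsq M) := by
  unfold wsq
  fun_prop

theorem wsq_smul (M : Matrix (Fin n) (Fin n) ℝ) (c : ℝ) (x : Fin n → ℝ) :
    wsq M (c • x) = c ^ 2 * wsq M x := by
  simp only [wsq, mulVec_smul, smul_dotProduct, dotProduct_smul, smul_eq_mul]
  ring

theorem wsq_zero (M : Matrix (Fin n) (Fin n) ℝ) : wsq M 0 = 0 := by simp [wsq]

theorem wsq_add (M : Matrix (Fin n) (Fin n) ℝ) (a b : Fin n → ℝ) :
    wsq M (a + b) = wsq M a + wsq M b + (a ⬝ᵥ M *ᵥ b + b ⬝ᵥ M *ᵥ a) := by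
  simp only [wsq, mulVec_add, add_dotProduct, dotProduct_add]
  ring

theorem wsq_sub (M : Matrix (Fin n) (Fin n) ℝ) (a b : Fin n → ℝ) :
    wsq M (a - b) = wsq M a + wsq M b - (a ⬝ᵥ M *ᵥ b + b ⬝ᵥ M *ᵥ a) := by
  simp only [wsq, mulVec_sub, sub_dotProduct, dotProduct_sub]
  ring

theorem wsq_combo (M : Matrix (Fin n) (Fin n) ℝ) (x y : Fin n → ℝ) {a b : ℝ} (hab : a + b = 1) :
    wsq M (a • x + b • y) = a * wsq M x + b * wsq M y - a * b * wsq M (x - y) := by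
  obtain rfl := eq_sub_of_add_eq' hab
  rw [wsq_add, wsq_sub]
  simp only [wsq_smul, mulVec_smul, smul_dotProduct, dotProduct_smul, smul_eq_mul]
  ring

theorem wsq_add_matrix (M M' : Matrix (Fin n) (Fin n) ℝ) (x : Fin n → ℝ) :
    wsq (M + M') x = wsq M x + wsq M' x := by
  simp [wsq, add_mulVec, dotProduct_add]

theorem wsq_transpose_mul_mul {m : ℕ} (M : Matrix (Fin n) (Fin n) ℝ)
    (X : Matrix (Fin n) (Fin m) ℝ) (x : Fin m → ℝ) : wsq (Xᵀ * M * X) x = wsq M (X *ᵥ x) := by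
  rw [wsq, wsq, ← mulVec_mulVec, ← mulVec_mulVec, dotProduct_mulVec, vecMul_transpose]

theorem wsq_nonneg (hM : M.PosSemidef) (x : Fin n → ℝ) : 0 ≤ wsq M x := by
  simpa [wsq] using hM.dotProduct_mulVec_nonneg x

theorem wsq_pos (hM : M.PosDef) {x : Fin n → ℝ} (hx : x ≠ 0) : 0 < wsq M x := by
  simpa [wsq] using hM.dotProduct_mulVec_pos hx

theorem mulVec_eq_zero_of_wsq_eq_zero (hM : M.PosSemidef) {x : Fin n → ℝ} (hx : wsq M x = 0) :
    M *ᵥ x = 0 := by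
  rw [← hM.dotProduct_mulVec_zero_iff]
  simpa [wsq] using hx

theorem eq_zero_of_wsq_eq_zero (hM : M.PosDef) {x : Fin n → ℝ} (hx : wsq M x = 0) : x = 0 :=
  by_contra fun hne => (wsq_pos hM hne).ne' hx

theorem wsq_add_le (hM : M.PosSemidef) {θ : ℝ} (hθ : 0 < θ) (a b : Fin n → ℝ) :
    wsq M (a + b) ≤ (1 + θ) * wsq M a + (1 + 1 / θ) * wsq M b := by
  have h_young : (1 + θ) * wsq M a + (1 + 1 / θ) * wsq M b - wsq M (a + b)
      = (1 / θ) * wsq M (θ • a - b) := by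
    rw [wsq_add, wsq_sub, wsq_smul]
    simp only [mulVec_smul, smul_dotProduct, dotProduct_smul, smul_eq_mul]
    field_simp
    ring
  exact sub_nonneg.1 (h_young ▸ mul_nonneg (by positivity) (wsq_nonneg hM _))

theorem exists_mul_sq_norm_le_wsq (hM : M.PosDef) :
    ∃ c : ℝ, 0 < c ∧ ∀ x, c * ‖x‖ ^ 2 ≤ wsq M x :=
  exists_mul_sq_norm_le_of_homogeneous (continuous_wsq M) (wsq_smul M) fun _ => wsq_pos hM

theorem nsq_eq_wsq_one (x : Fin n → ℝ) : nsq x = wsq 1 x := by simp [nsq, wsq]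

theorem nsq_nonneg (x : Fin n → ℝ) : 0 ≤ nsq x :=
  nsq_eq_wsq_one x ▸ wsq_nonneg PosSemidef.one x

variable (n) in
theorem exists_mul_sq_norm_le_nsq : ∃ c : ℝ, 0 < c ∧ ∀ x : Fin n → ℝ, c * ‖x‖ ^ 2 ≤ nsq x := by
  simpa only [nsq_eq_wsq_one] using exists_mul_sq_norm_le_wsq (PosDef.one (n := Fin n) (R := ℝ))

theorem nsq_combo_sub (v w r : Fin n → ℝ) {a b : ℝ} (hab : a + b = 1) :
    nsq (a • v + b • w - r) = a * nsq (v - r) + b * nsq (w - r) - a * b * nsq (v - w) := by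
  have h_sub : a • v + b • w - r = a • (v - r) + b • (w - r) := by
    rw [smul_sub, smul_sub, sub_add_sub_comm, ← add_smul, hab, one_smul]
  simp only [nsq_eq_wsq_one, h_sub, wsq_combo 1 _ _ hab, sub_sub_sub_cancel_right]

theorem strictConvexOn_nsq_sub (r : Fin n → ℝ) :
    StrictConvexOn ℝ univ fun v => nsq (v - r) :=
  strictConvexOn_of_defect (fun v w _ _ => nsq_combo_sub v w r)
    fun x hx => nsq_eq_wsq_one x ▸ wsq_pos PosDef.one hx

theorem existsUnique_nearest {s : Set (Fin n → ℝ)} (hs : IsClosed s) (hs_conv : Convex ℝ s)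
    (hs_ne : s.Nonempty) (r : Fin n → ℝ) :
    ∃! v, v ∈ s ∧ IsMinOn (fun w => nsq (w - r)) s v := by
  obtain ⟨c, hc, h_lower⟩ := exists_mul_sq_norm_le_nsq n
  exact existsUnique_isMinOn hs hs_ne (by unfold nsq; fun_prop)
    ((strictConvexOn_nsq_sub r).subset (subset_univ s) hs_conv)
    (tendsto_cocompact_atTop_of_mul_sq_norm_le hc fun v => h_lower (v - r))

theorem nsq_sub_le_of_isMinOn {s : Set (Fin n → ℝ)} (hs : Convex ℝ s) {r v w : Fin n → ℝ}
    (hv : v ∈ s) (hv_min : IsMinOn (fun w => nsq (w - r)) s v) (hw : w ∈ s) :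
    nsq (v - w) ≤ 2 * (nsq (w - r) - nsq (v - r)) := by
  have h_mid := hv_min (hs hv hw (a := 1 / 2) (b := 1 / 2) (by norm_num) (by norm_num)
    (by norm_num))
  simp only [mem_ofPred_eq, nsq_combo_sub v w r (add_halves 1)] at h_mid
  linarith

end WeightedSquare

/-! ### Schur matrices -/

section Schur

variable {n : ℕ}

theorem mulVec_eq_smul_iff_re_im (M : Matrix (Fin n) (Fin n) ℝ) (z : ℂ) (w : Fin n → ℂ) :
    M.map (algebraMap ℝ ℂ) *ᵥ w = z • w ↔
      (M *ᵥ (fun i => (w i).re) = z.re • (fun i => (w i).re) - z.im • (fun i => (w i).im) ∧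
        M *ᵥ (fun i => (w i).im) =
          z.re • (fun i => (w i).im) + z.im • (fun i => (w i).re)) := by
  simp only [funext_iff, Pi.smul_apply, Pi.sub_apply, Pi.add_apply, smul_eq_mul, ← forall_and]
  refine forall_congr' fun i => ?_
  simp only [Complex.ext_iff, mulVec, dotProduct, map_apply, Complex.coe_algebraMap,
    Complex.re_sum, Complex.im_sum, Complex.mul_re, Complex.mul_im, Complex.ofReal_re,
    Complex.ofReal_im, zero_mul, sub_zero, add_zero]

theorem mem_spectrum_map_iff (M : Matrix (Fin n) (Fin n) ℝ) (z : ℂ) :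
    z ∈ spectrum ℂ (M.map (algebraMap ℝ ℂ)) ↔ ∃ a b : Fin n → ℝ, (a ≠ 0 ∨ b ≠ 0) ∧
      M *ᵥ a = z.re • a - z.im • b ∧ M *ᵥ b = z.re • b + z.im • a := by
  have h_spec : z ∈ spectrum ℂ (M.map (algebraMap ℝ ℂ)) ↔
      ∃ w ≠ 0, M.map (algebraMap ℝ ℂ) *ᵥ w = z • w := by
    rw [spectrum.mem_iff, Matrix.isUnit_iff_isUnit_det, isUnit_iff_ne_zero, not_not,
      ← Matrix.exists_mulVec_eq_zero_iff]
    simp only [sub_mulVec, sub_eq_zero, Algebra.algebraMap_eq_smul_one, smul_mulVec, one_mulVec,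
      eq_comm]
  simp only [h_spec, mulVec_eq_smul_iff_re_im]
  constructor
  · rintro ⟨w, hw, h⟩
    refine ⟨_, _, ?_, h⟩
    by_contra! h0
    exact hw (funext fun i => Complex.ext (congrFun h0.1 i) (congrFun h0.2 i))
  · rintro ⟨a, b, hab, h⟩
    refine ⟨fun i => ⟨a i, b i⟩, fun h0 => ?_, h⟩
    have ha : a = 0 := funext fun i => congrArg Complex.re (congrFun h0 i)
    have hb : b = 0 := funext fun i => congrArg Complex.im (congrFun h0 i)
    exact hab.elim (· ha) (· hb)

theorem wsq_sub_add_wsq_add (M : Matrix (Fin n) (Fin n) ℝ) (s t : ℝ) (a b : Fin n → ℝ) :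
    wsq M (s • a - t • b) + wsq M (s • b + t • a) = (s ^ 2 + t ^ 2) * (wsq M a + wsq M b) := by
  rw [wsq_sub, wsq_add]
  simp only [wsq_smul, mulVec_smul, smul_dotProduct, dotProduct_smul, smul_eq_mul]
  ring

theorem isSchur_of_lyapunov {m : ℕ} {A Q P : Matrix (Fin n) (Fin n) ℝ}
    {B : Matrix (Fin n) (Fin m) ℝ} {K : Matrix (Fin m) (Fin n) ℝ} {R : Matrix (Fin m) (Fin m) ℝ}
    (hP : P.PosSemidef) (hQ : Q.PosSemidef) (hR : R.PosDef) (hDet : Detectable A Q)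
    (h : ∀ x, wsq P x = wsq Q x + wsq R (K *ᵥ x) + wsq P ((A - B * K) *ᵥ x)) :
    IsSchur (A - B * K) := by
  intro z hz
  by_contra! hz1
  obtain ⟨L, hL⟩ := hDet
  obtain ⟨a, b, hab, ha, hb⟩ := (mem_spectrum_map_iff _ z).1 hz
  have h_norm : 1 ≤ z.re ^ 2 + z.im ^ 2 := by
    have : ‖z‖ ^ 2 = z.re ^ 2 + z.im ^ 2 := by
      rw [Complex.sq_norm, Complex.normSq_apply]
      ring
    nlinarith
  have h_decay : wsq P a + wsq P b =
      (wsq Q a + wsq R (K *ᵥ a)) + (wsq Q b + wsq R (K *ᵥ b)) +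
        (z.re ^ 2 + z.im ^ 2) * (wsq P a + wsq P b) := by
    rw [← wsq_sub_add_wsq_add, ← ha, ← hb]
    linarith [h a, h b]
  have h_growth : wsq P a + wsq P b ≤ (z.re ^ 2 + z.im ^ 2) * (wsq P a + wsq P b) :=
    le_mul_of_one_le_left (add_nonneg (wsq_nonneg hP a) (wsq_nonneg hP b)) h_norm
  have hQa := wsq_nonneg hQ a
  have hQb := wsq_nonneg hQ b
  have hRa := wsq_nonneg hR.posSemidef (K *ᵥ a)
  have hRb := wsq_nonneg hR.posSemidef (K *ᵥ b)
  -- The eigenvector is invisible to `Q` and `K`, so output injection leaves the eigenvalue alone.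
  have h_eq : ∀ x, wsq Q x = 0 → wsq R (K *ᵥ x) = 0 →
      (A - L * Q) *ᵥ x = (A - B * K) *ᵥ x := by
    intro x hQx hRx
    rw [sub_mulVec, sub_mulVec, ← mulVec_mulVec, ← mulVec_mulVec,
      mulVec_eq_zero_of_wsq_eq_zero hQ hQx, eq_zero_of_wsq_eq_zero hR hRx, mulVec_zero,
      mulVec_zero]
  have hz_mem : z ∈ spectrum ℂ ((A - L * Q).map (algebraMap ℝ ℂ)) :=
    (mem_spectrum_map_iff _ z).2 ⟨a, b, hab, by rw [h_eq a (by linarith) (by linarith), ha],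
      by rw [h_eq b (by linarith) (by linarith), hb]⟩
  exact (hL z hz_mem).not_ge hz1

end Schur

section PowerDecay

theorem exists_norm_pow_le_of_spectralRadius_lt_one {R : Type*} [NormedRing R] [NormedAlgebra ℂ R]
    [CompleteSpace R] {a : R} (ha : spectralRadius ℂ a < 1) :
    ∃ c : ℝ, 0 < c ∧ c < 1 ∧ ∃ m : ℕ, 0 < m ∧ ‖a ^ m‖ ≤ c ^ m := by
  obtain ⟨c, hac, hc1⟩ := ENNReal.lt_iff_exists_nnreal_btwn.1 ha
  have h_lim := spectrum.pow_nnnorm_pow_one_div_tendsto_nhds_spectralRadius a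
  obtain ⟨m, hm, hm0⟩ :=
    ((h_lim.eventually (gt_mem_nhds hac)).and (eventually_gt_atTop 0)).exists
  refine ⟨c, by exact_mod_cast pos_of_gt hac, by exact_mod_cast hc1, m, hm0, ?_⟩
  have h_pow : ‖a ^ m‖₊ ≤ c ^ m := by
    rw [one_div, ENNReal.rpow_inv_lt_iff (by positivity), ENNReal.rpow_natCast] at hm
    exact_mod_cast hm.le
  exact_mod_cast h_pow

open scoped Matrix.Norms.Operator in
theorem IsSchur.exists_norm_pow_mulVec_le {n : ℕ} {M : Matrix (Fin n) (Fin n) ℝ}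
    (hM : IsSchur M) :
    ∃ c : ℝ, 0 < c ∧ c < 1 ∧ ∃ m : ℕ, 0 < m ∧ ∀ x : Fin n → ℝ, ‖M ^ m *ᵥ x‖ ≤ c ^ m * ‖x‖ := by
  have h_radius : spectralRadius ℂ (M.map (algebraMap ℝ ℂ)) < 1 := by
    rcases isEmpty_or_nonempty (Fin n) with _ | _
    · simp [spectrum.SpectralRadius.of_subsingleton]
    · exact spectrum.spectralRadius_lt_of_forall_lt (r := 1) _ hM
  obtain ⟨c, hc0, hc1, m, hm, h_pow⟩ := exists_norm_pow_le_of_spectralRadius_lt_one h_radius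
  have h_real : ‖M ^ m‖ = ‖M.map (algebraMap ℝ ℂ) ^ m‖ := by
    rw [← Matrix.map_pow]
    simp [linfty_opNorm_def]
  refine ⟨c, hc0, hc1, m, hm, fun x => (linfty_opNorm_mulVec _ x).trans ?_⟩
  rw [h_real]
  gcongr

variable {E : Type*} [NormedAddCommGroup E] [NormedSpace ℝ E]

theorem exists_adapted_seminorm (f : E →L[ℝ] E) {c : ℝ} (hc : 0 < c) {m : ℕ} (hm : 0 < m)
    (hf : ∀ x, ‖(f ^ m) x‖ ≤ c ^ m * ‖x‖) :
    ∃ (p : Seminorm ℝ E) (C : ℝ), 0 < C ∧ (∀ x, ‖x‖ ≤ p x) ∧ (∀ x, p x ≤ C * ‖x‖) ∧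
      ∀ x, p (f x) ≤ c * p x := by
  let q (x : E) : ℝ := ∑ i ∈ Finset.range m, c⁻¹ ^ i * ‖(f ^ i) x‖
  have q_add (x y : E) : q (x + y) ≤ q x + q y := by
    simp only [q, ← Finset.sum_add_distrib, ← mul_add, map_add]
    gcongr
    exact norm_add_le _ _
  have q_smul (a : ℝ) (x : E) : q (a • x) = ‖a‖ * q x := by
    simp only [q, map_smul, norm_smul, Finset.mul_sum, mul_left_comm]
  have le_q (x : E) : ‖x‖ ≤ q x := by
    have h := Finset.single_le_sum (f := fun i => c⁻¹ ^ i * ‖(f ^ i) x‖)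
      (fun i _ => by positivity) (Finset.mem_range.2 hm)
    rwa [pow_zero, pow_zero, one_mul, one_apply_eq_self] at h
  have q_le (x : E) : q x ≤ (1 + ∑ i ∈ Finset.range m, c⁻¹ ^ i * ‖f ^ i‖) * ‖x‖ := by
    rw [add_mul, one_mul, Finset.sum_mul]
    refine le_add_of_nonneg_of_le (norm_nonneg _) (Finset.sum_le_sum fun i _ => ?_)
    rw [mul_assoc]
    gcongr
    exact (f ^ i).le_opNorm x
  have q_apply (x : E) : q (f x) ≤ c * q x := by
    let t (i : ℕ) : ℝ := c⁻¹ ^ i * ‖(f ^ i) x‖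
    have h_shift (i : ℕ) : c⁻¹ ^ i * ‖(f ^ i) (f x)‖ = c * t (i + 1) := by
      simp only [t, pow_succ f, mul_apply_eq_comp, pow_succ c⁻¹]
      field_simp
    have h_last : t m ≤ t 0 := by
      simpa [t, inv_mul_le_iff₀ (pow_pos hc m)] using hf x
    have h_sum : ∑ i ∈ Finset.range m, t (i + 1) ≤ ∑ i ∈ Finset.range m, t i := by
      linarith [Finset.sum_range_succ t m, Finset.sum_range_succ' t m]
    simp only [q, h_shift, ← Finset.mul_sum]
    gcongr
  exact ⟨Seminorm.of q q_add q_smul, _, by positivity, le_q, q_le, q_apply⟩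

/-- The continuous linear map `x ↦ M *ᵥ x`, through which the operator-norm and polyhedral lemmas
are applied to matrices. -/
noncomputable def mulVecCLM {m n : ℕ} (M : Matrix (Fin m) (Fin n) ℝ) :
    (Fin n → ℝ) →L[ℝ] (Fin m → ℝ) :=
  LinearMap.toContinuousLinearMap M.mulVecLin

@[simp]
theorem mulVecCLM_apply {m n : ℕ} (M : Matrix (Fin m) (Fin n) ℝ) (x : Fin n → ℝ) :
    mulVecCLM M x = M *ᵥ x :=
  rfl

theorem mulVecCLM_pow_apply {n : ℕ} (M : Matrix (Fin n) (Fin n) ℝ) (k : ℕ) (x : Fin n → ℝ) :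
    (mulVecCLM M ^ k) x = M ^ k *ᵥ x := by
  induction k generalizing x with
  | zero => simp
  | succ k ih => rw [pow_succ, pow_succ, mul_apply_eq_comp, ih, mulVecCLM_apply,
      mulVec_mulVec]

theorem IsSchur.exists_adapted_seminorm {n : ℕ} {M : Matrix (Fin n) (Fin n) ℝ}
    (hM : IsSchur M) :
    ∃ (c : ℝ) (p : Seminorm ℝ (Fin n → ℝ)) (C : ℝ), 0 < c ∧ c < 1 ∧ 0 < C ∧ (∀ x, ‖x‖ ≤ p x) ∧
      (∀ x, p x ≤ C * ‖x‖) ∧ ∀ x, p (M *ᵥ x) ≤ c * p x := by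
  obtain ⟨c, hc0, hc1, m, hm, h_pow⟩ := hM.exists_norm_pow_mulVec_le
  obtain ⟨p, C, hC, h⟩ := FeasGov.exists_adapted_seminorm (mulVecCLM M) hc0 hm
    (by simpa only [mulVecCLM_pow_apply] using h_pow)
  exact ⟨c, p, C, hc0, hc1, hC, h⟩

theorem IsSchur.exists_geometric_decay {n : ℕ} {M : Matrix (Fin n) (Fin n) ℝ} (hM : IsSchur M) :
    ∃ c C : ℝ, 0 < c ∧ c < 1 ∧ 0 < C ∧ ∀ i x, ‖M ^ i *ᵥ x‖ ≤ C * c ^ i * ‖x‖ := by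
  obtain ⟨c, p, C, hc0, hc1, hC, hp_ge, hp_le, hp_contract⟩ := hM.exists_adapted_seminorm
  refine ⟨c, C, hc0, hc1, hC, fun i x => ?_⟩
  have h_iter : p (M ^ i *ᵥ x) ≤ c ^ i * p x := by
    induction i with
    | zero => simp
    | succ i ih =>
      rw [pow_succ', ← mulVec_mulVec, pow_succ', mul_assoc]
      exact (hp_contract _).trans (by gcongr)
  calc ‖M ^ i *ᵥ x‖ ≤ c ^ i * p x := (hp_ge _).trans h_iter
    _ ≤ c ^ i * (C * ‖x‖) := by gcongr; exact hp_le x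
    _ = C * c ^ i * ‖x‖ := by ring

theorem IsSchur.tendsto_comp_pow {m n : ℕ} {M : Matrix (Fin n) (Fin n) ℝ} (hM : IsSchur M)
    (H : Matrix (Fin m) (Fin n) ℝ) :
    Tendsto (fun i => mulVecCLM (H * M ^ i)) atTop (𝓝 0) := by
  obtain ⟨c, C, hc0, hc1, hC, h_decay⟩ := hM.exists_geometric_decay
  have h_lim : Tendsto (fun i : ℕ => ‖mulVecCLM H‖ * (C * c ^ i)) atTop (𝓝 0) := by
    simpa using ((tendsto_pow_atTop_nhds_zero_of_lt_one hc0.le hc1).const_mul C).const_mul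
      ‖mulVecCLM H‖
  refine squeeze_zero_norm (fun i => ContinuousLinearMap.opNorm_le_bound _ (by positivity)
    fun x => ?_) h_lim
  rw [mulVecCLM_apply, ← mulVec_mulVec, mul_assoc]
  exact ((mulVecCLM H).le_opNorm _).trans (by gcongr; exact h_decay i x)

end PowerDecay

/-! ### Finite determination of sequences of linear maps -/

section FiniteDetermination

variable {E F : Type*} [NormedAddCommGroup E] [NormedSpace ℝ E] [NormedAddCommGroup F]
  [NormedSpace ℝ F]

theorem exists_forall_apply_eq_zero {R M N : Type*} [Ring R] [AddCommGroup M] [Module R M]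
    [IsArtinian R M] [AddCommGroup N] [Module R N] (f : ℕ → M →ₗ[R] N) :
    ∃ k, ∀ x, (∀ j < k, f j x = 0) → ∀ j, f j x = 0 := by
  let ker : ℕ →o (Submodule R M)ᵒᵈ :=
    { toFun k := OrderDual.toDual (⨅ j < k, LinearMap.ker (f j))
      monotone' k l hkl := OrderDual.toDual_le_toDual.2
        (biInf_mono fun _ hj => hj.trans_le hkl) }
  have mem_ker (k : ℕ) (x : M) : x ∈ OrderDual.ofDual (ker k) ↔ ∀ j < k, f j x = 0 := by
    simp [ker]
  obtain ⟨k, hk⟩ := IsArtinian.monotone_stabilizes ker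
  refine ⟨k, fun x hx j => ?_⟩
  have h_mem := (mem_ker k x).2 hx
  rw [hk (max k (j + 1)) (le_max_left _ _)] at h_mem
  exact (mem_ker _ x).1 h_mem j (by simp)

variable [FiniteDimensional ℝ E]

theorem exists_norm_le_forall_apply_eq [FiniteDimensional ℝ F] (f : ℕ → E →L[ℝ] F) :
    ∃ (k : ℕ) (C : ℝ), ∀ (x : E) (M : ℝ), 0 ≤ M → (∀ j < k, ‖f j x‖ ≤ M) →
      ∃ y, ‖y‖ ≤ C * M ∧ ∀ j, f j y = f j x := by
  obtain ⟨k, hk⟩ := exists_forall_apply_eq_zero fun j => (f j : E →ₗ[ℝ] F)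
  let Φ : E →L[ℝ] (Fin k → F) := ContinuousLinearMap.pi fun j => f j
  have : CompleteSpace E := FiniteDimensional.complete ℝ E
  have : CompleteSpace Φ.range := FiniteDimensional.complete ℝ _
  obtain ⟨C, hC, h_pre⟩ := Φ.rangeRestrict.exists_preimage_norm_le
    Φ.toLinearMap.surjective_rangeRestrict
  refine ⟨k, C, fun x M hM hx => ?_⟩
  obtain ⟨y, hy, hy_norm⟩ := h_pre (Φ.rangeRestrict x)
  have hΦ : ‖Φ x‖ ≤ M := (pi_norm_le_iff_of_nonneg hM).2 fun j => hx j j.2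
  refine ⟨y, hy_norm.trans (by gcongr; exact hΦ), fun j => ?_⟩
  have hΦy : Φ y = Φ x := congrArg Subtype.val hy
  have h_zero := hk (y - x) (fun i hi => ?_) j
  · simpa [sub_eq_zero] using h_zero
  · have h_eq : f i y = f i x := congrFun hΦy ⟨i, hi⟩
    simpa [sub_eq_zero] using h_eq

theorem exists_norm_apply_le_of_forall_lt [FiniteDimensional ℝ F] {f : ℕ → E →L[ℝ] F}
    (hf : Tendsto f atTop (𝓝 0)) {M : ℝ} (hM : 0 ≤ M) {η : ℝ} (hη : 0 < η) :
    ∃ J : ℕ, ∀ x, (∀ j < J, ‖f j x‖ ≤ M) → ∀ j, J ≤ j → ‖f j x‖ ≤ η := by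
  obtain ⟨k, C, hk⟩ := exists_norm_le_forall_apply_eq f
  have h_lim : Tendsto (fun j => ‖f j‖ * (C * M)) atTop (𝓝 0) := by
    simpa using hf.norm.mul_const (C * M)
  obtain ⟨J, hJ⟩ := eventually_atTop.1 (h_lim.eventually (gt_mem_nhds hη))
  refine ⟨max J k, fun x hx j hj => ?_⟩
  obtain ⟨y, hy_norm, hy⟩ := hk x M hM fun i hi => hx i (hi.trans_le (le_max_right _ _))
  rw [← hy j]
  calc ‖f j y‖ ≤ ‖f j‖ * (C * M) := (f j).le_opNorm_of_le hy_norm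
    _ ≤ η := (hJ j (le_of_max_le_left hj)).le

end FiniteDetermination

/-! ### The linear-quadratic regulator -/

section Riccati

variable {n m : ℕ} {A P Q : Matrix (Fin n) (Fin n) ℝ} {B : Matrix (Fin n) (Fin m) ℝ}
  {R W : Matrix (Fin m) (Fin m) ℝ} {K : Matrix (Fin m) (Fin n) ℝ}

theorem wsq_add_of_transpose_eq (hP : Pᵀ = P) (a b : Fin n → ℝ) :
    wsq P (a + b) = wsq P a + wsq P b + 2 * (b ⬝ᵥ P *ᵥ a) := by
  have h_symm : a ⬝ᵥ P *ᵥ b = b ⬝ᵥ P *ᵥ a := by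
    rw [dotProduct_comm, ← vecMul_transpose, hP, ← dotProduct_mulVec]
  rw [wsq_add, h_symm, two_mul]

theorem wsq_complete_square (hP : Pᵀ = P) (hW : Wᵀ = W) (hW_eq : W = R + Bᵀ * P * B)
    (hK : W * K = Bᵀ * P * A) (hRic : P + Kᵀ * W * K = Q + Aᵀ * P * A) (e : Fin n → ℝ)
    (w : Fin m → ℝ) :
    wsq P (A *ᵥ e + B *ᵥ w) + (wsq Q e + wsq R w) = wsq P e + wsq W (w + K *ᵥ e) := by
  have h_state : wsq P e + wsq W (K *ᵥ e) = wsq Q e + wsq P (A *ᵥ e) := by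
    simp only [← wsq_transpose_mul_mul, ← wsq_add_matrix, hRic]
  have h_input : wsq W w = wsq R w + wsq P (B *ᵥ w) := by
    rw [hW_eq, wsq_add_matrix, wsq_transpose_mul_mul]
  have h_cross : w ⬝ᵥ W *ᵥ (K *ᵥ e) = (B *ᵥ w) ⬝ᵥ P *ᵥ (A *ᵥ e) := by
    rw [mulVec_mulVec, hK, ← mulVec_mulVec, ← mulVec_mulVec, dotProduct_mulVec, vecMul_transpose]
  rw [wsq_add_of_transpose_eq hP, add_comm w, wsq_add_of_transpose_eq hW, h_cross]
  linarith

end Riccati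

namespace Data

variable {nx nu ny nz nc : ℕ} (S : Data nx nu ny nz nc)

/-- The assumptions under which the terminal law is a stabilizing linear-quadratic regulator that
keeps the system at the steady states `(Gx v, Gu v)`. -/
structure RegulatorAssumptions : Prop where
  equilibrium : S.A * S.Gx + S.B * S.Gu = S.Gx
  Q_posSemidef : S.Q.PosSemidef
  R_posDef : S.R.PosDef
  detectable : Detectable S.A S.Q
  riccati : S.IsRiccatiSolution

/-- The closed-loop matrix under the terminal law. -/
noncomputable def closedMatrix : Matrix (Fin nx) (Fin nx) ℝ := S.A - S.B * S.K

/-- The weight `R + Bᵀ P B` of deviations of the input from the terminal law. -/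
def lqrWeight : Matrix (Fin nu) (Fin nu) ℝ := S.R + S.Bᵀ * S.P * S.B

/-- The input of the terminal law with reference `v` in the state `x`. -/
noncomputable def termInput (v : Fin nz → ℝ) (x : Fin nx → ℝ) : Fin nu → ℝ :=
  S.Gu *ᵥ v - S.K *ᵥ (x - S.Gx *ᵥ v)

theorem termStep_eq (v : Fin nz → ℝ) (x : Fin nx → ℝ) :
    S.termStep v x = S.A *ᵥ x + S.B *ᵥ S.termInput v x := by
  simp only [termStep, termInput, sub_mulVec, mulVec_sub, mulVec_add, mulVec_mulVec]
  abel

theorem termOut_eq (v : Fin nz → ℝ) (x : Fin nx → ℝ) :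
    S.termOut v x = S.C *ᵥ x + S.D *ᵥ S.termInput v x := by
  simp only [termOut, termInput, sub_mulVec, mulVec_sub, mulVec_add, mulVec_mulVec]
  abel

variable {S}

theorem IsEquilibriumBasis.mul_add_mul_eq (hG : S.IsEquilibriumBasis) :
    S.A * S.Gx + S.B * S.Gu = S.Gx := by
  have h_ker : S.Z * S.G = 0 := by
    refine Matrix.ext_col fun j => ?_
    have h_col : S.G.col j ∈ LinearMap.ker S.Z.mulVecLin :=
      hG.2 ▸ Submodule.subset_span (mem_range_self j)
    exact h_col
  have h_top : (S.A - 1) * S.Gx + S.B * S.Gu = 0 := by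
    rw [Z, G, fromBlocks_mul_fromRows, fromCols_mul_fromRows, Matrix.zero_mul, add_zero] at h_ker
    exact congrArg toRows₁ h_ker
  rwa [Matrix.sub_mul, Matrix.one_mul, sub_add_eq_add_sub, sub_eq_zero] at h_top

namespace RegulatorAssumptions

theorem lqrWeight_posDef (hS : S.RegulatorAssumptions) : S.lqrWeight.PosDef :=
  hS.R_posDef.add_posSemidef (by simpa using hS.riccati.1.conjTranspose_mul_mul_same S.B)

theorem lqrWeight_mul_K (hS : S.RegulatorAssumptions) :
    S.lqrWeight * S.K = S.Bᵀ * S.P * S.A := by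
  rw [K, ← Matrix.mul_assoc, ← lqrWeight, Matrix.mul_nonsing_inv, Matrix.one_mul]
  exact (Matrix.isUnit_iff_isUnit_det _).1 hS.lqrWeight_posDef.isUnit

theorem transpose_P (hS : S.RegulatorAssumptions) : S.Pᵀ = S.P := by
  simpa [Matrix.IsSymm] using hS.riccati.1.isHermitian

theorem transpose_lqrWeight (hS : S.RegulatorAssumptions) : S.lqrWeightᵀ = S.lqrWeight := by
  simpa [Matrix.IsSymm] using hS.lqrWeight_posDef.isHermitian

theorem transpose_K (hS : S.RegulatorAssumptions) :
    S.Kᵀ = S.Aᵀ * S.P * S.B * (S.R + S.Bᵀ * S.P * S.B)⁻¹ := by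
  have h_symm : (S.R + S.Bᵀ * S.P * S.B)ᵀ = S.R + S.Bᵀ * S.P * S.B := hS.transpose_lqrWeight
  rw [K, transpose_mul, transpose_nonsing_inv, h_symm]
  simp only [transpose_mul, transpose_transpose, hS.transpose_P, Matrix.mul_assoc]

theorem riccati_eq (hS : S.RegulatorAssumptions) :
    S.P + S.Kᵀ * S.lqrWeight * S.K = S.Q + S.Aᵀ * S.P * S.A := by
  rw [Matrix.mul_assoc, hS.lqrWeight_mul_K, hS.transpose_K]
  nth_rewrite 1 [hS.riccati.2]
  abel

theorem bellman_eq (hS : S.RegulatorAssumptions) (e : Fin nx → ℝ) (w : Fin nu → ℝ) :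
    wsq S.P (S.A *ᵥ e + S.B *ᵥ w) + (wsq S.Q e + wsq S.R w) =
      wsq S.P e + wsq S.lqrWeight (w + S.K *ᵥ e) :=
  wsq_complete_square hS.transpose_P hS.transpose_lqrWeight rfl hS.lqrWeight_mul_K hS.riccati_eq
    e w

theorem isSchur_closedMatrix (hS : S.RegulatorAssumptions) : IsSchur S.closedMatrix := by
  refine isSchur_of_lyapunov hS.riccati.1 hS.Q_posSemidef hS.R_posDef hS.detectable fun x => ?_
  have h_neg : wsq S.R (-(S.K *ᵥ x)) = wsq S.R (S.K *ᵥ x) := by simp [wsq, mulVec_neg]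
  have h := hS.bellman_eq x (-(S.K *ᵥ x))
  rw [neg_add_cancel, wsq_zero, h_neg, mulVec_neg, ← sub_eq_add_neg, mulVec_mulVec,
    ← sub_mulVec] at h
  linarith

theorem step_steadyState (hS : S.RegulatorAssumptions) (v : Fin nz → ℝ) :
    S.A *ᵥ (S.Gx *ᵥ v) + S.B *ᵥ (S.Gu *ᵥ v) = S.Gx *ᵥ v := by
  rw [mulVec_mulVec, mulVec_mulVec, ← add_mulVec, hS.equilibrium]

theorem step_sub (hS : S.RegulatorAssumptions) (v : Fin nz → ℝ) (x : Fin nx → ℝ)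
    (u : Fin nu → ℝ) :
    S.A *ᵥ x + S.B *ᵥ u - S.Gx *ᵥ v =
      S.A *ᵥ (x - S.Gx *ᵥ v) + S.B *ᵥ (u - S.Gu *ᵥ v) := by
  conv_lhs => rw [← hS.step_steadyState v]
  rw [mulVec_sub, mulVec_sub]
  abel

theorem step_sub_eq_closedMatrix (hS : S.RegulatorAssumptions) (v : Fin nz → ℝ)
    (x : Fin nx → ℝ) (u : Fin nu → ℝ) :
    S.A *ᵥ x + S.B *ᵥ u - S.Gx *ᵥ v =
      S.closedMatrix *ᵥ (x - S.Gx *ᵥ v) + S.B *ᵥ (u - S.termInput v x) := by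
  rw [hS.step_sub, closedMatrix, termInput, sub_mulVec, ← mulVec_mulVec]
  simp only [mulVec_sub]
  abel

theorem termStep_sub (hS : S.RegulatorAssumptions) (v : Fin nz → ℝ) (x : Fin nx → ℝ) :
    S.termStep v x - S.Gx *ᵥ v = S.closedMatrix *ᵥ (x - S.Gx *ᵥ v) := by
  rw [termStep_eq, hS.step_sub_eq_closedMatrix, sub_self, mulVec_zero, add_zero]

theorem iterate_termStep_sub (hS : S.RegulatorAssumptions) (v : Fin nz → ℝ) (x : Fin nx → ℝ)
    (j : ℕ) :
    (S.termStep v)^[j] x - S.Gx *ᵥ v = S.closedMatrix ^ j *ᵥ (x - S.Gx *ᵥ v) := by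
  induction j with
  | zero => simp
  | succ j ih =>
    rw [Function.iterate_succ_apply', hS.termStep_sub, ih, mulVec_mulVec, pow_succ']

end RegulatorAssumptions

/-! ### The optimal control problem -/

section Fiber

variable {E F : Type*} [AddCommGroup E] [Module ℝ E] [AddCommGroup F] [Module ℝ F]

theorem combo_mk (x : E) (y z : F) {a b : ℝ} (hab : a + b = 1) :
    a • (x, y) + b • (x, z) = (x, a • y + b • z) :=
  Prod.ext (Convex.combo_self hab x) rfl

theorem convex_prodMk_preimage {s : Set (E × F)} (hs : Convex ℝ s) (x : E) :
    Convex ℝ (Prod.mk x ⁻¹' s) := fun y hy z hz a b ha hb hab => by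
  rw [mem_preimage, ← combo_mk x y z hab]
  exact hs hy hz ha hb hab

end Fiber

variable (S)

/-- Initial state, reference and input sequence of an optimal control problem. -/
abbrev Plan : Type := ((Fin nx → ℝ) × (Fin nz → ℝ)) × (Fin S.N → Fin nu → ℝ)

/-- The predicted state as a continuous linear map of the plan. -/
noncomputable def predMap : ℕ → S.Plan →L[ℝ] (Fin nx → ℝ)
  | 0 => ContinuousLinearMap.fst ℝ _ _ ∘L ContinuousLinearMap.fst ℝ _ _
  | i + 1 => mulVecCLM S.A ∘L predMap i + mulVecCLM S.B ∘L
      (if hi : i < S.N then ContinuousLinearMap.proj ⟨i, hi⟩ ∘L ContinuousLinearMap.snd ℝ _ _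
        else 0)

theorem predMap_apply (i : ℕ) (p : S.Plan) : S.predMap i p = S.pred p.1.1 p.2 i := by
  induction i with
  | zero => rfl
  | succ i ih =>
    simp only [predMap, pred, _root_.add_apply, ContinuousLinearMap.comp_apply, ih,
      mulVecCLM_apply]
    split_ifs <;> rfl

theorem pred_succ (x : Fin nx → ℝ) (μ : Fin S.N → Fin nu → ℝ) (i : Fin S.N) :
    S.pred x μ (i + 1) = S.A *ᵥ S.pred x μ i + S.B *ᵥ μ i := by
  simp [pred]

/-- The deviation of the `i`-th input of a plan from the terminal law, as a continuous linear map
of the plan. -/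
noncomputable def lqrDeviation (i : Fin S.N) : S.Plan →L[ℝ] (Fin nu → ℝ) :=
  ContinuousLinearMap.proj (φ := fun _ => Fin nu → ℝ) i ∘L ContinuousLinearMap.snd ℝ _ _
    - (mulVecCLM S.Gu ∘L ContinuousLinearMap.snd ℝ _ _ ∘L ContinuousLinearMap.fst ℝ _ _
      - mulVecCLM S.K ∘L (S.predMap i
        - mulVecCLM S.Gx ∘L ContinuousLinearMap.snd ℝ _ _ ∘L ContinuousLinearMap.fst ℝ _ _))

theorem lqrDeviation_apply (x : Fin nx → ℝ) (v : Fin nz → ℝ) (μ : Fin S.N → Fin nu → ℝ)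
    (i : Fin S.N) : S.lqrDeviation i ((x, v), μ) = μ i - S.termInput v (S.pred x μ i) := by
  simp [lqrDeviation, termInput, predMap_apply, mulVec_sub]

/-- The part `∑ᵢ ‖μᵢ - termInput v ξᵢ‖²_W`, with `W = R + Bᵀ P B`, of the cost of a plan that is
due to the deviations from the terminal law. -/
noncomputable def deviationCost (p : S.Plan) : ℝ := ∑ i, wsq S.lqrWeight (S.lqrDeviation i p)

theorem continuous_deviationCost : Continuous S.deviationCost :=
  continuous_finsetSum _ fun i _ => (continuous_wsq _).comp (S.lqrDeviation i).continuous

theorem deviationCost_smul (c : ℝ) (p : S.Plan) :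
    S.deviationCost (c • p) = c ^ 2 * S.deviationCost p := by
  simp only [deviationCost, map_smul, wsq_smul, Finset.mul_sum]

theorem deviationCost_combo (p q : S.Plan) {a b : ℝ} (hab : a + b = 1) :
    S.deviationCost (a • p + b • q) =
      a * S.deviationCost p + b * S.deviationCost q - a * b * S.deviationCost (p - q) := by
  simp only [deviationCost, map_smul, map_add, map_sub, wsq_combo _ _ _ hab,
    Finset.sum_sub_distrib, Finset.sum_add_distrib, Finset.mul_sum]

/-- The plans satisfying the constraints of the optimal control problem. -/
def feasiblePlans : Set S.Plan := {p | S.OCPFeasible p.1.1 p.1.2 p.2}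

variable {S}

theorem isOCPMinimizer_iff {x : Fin nx → ℝ} {v : Fin nz → ℝ} {μ : Fin S.N → Fin nu → ℝ} :
    S.IsOCPMinimizer x v μ ↔ μ ∈ {ν | S.OCPFeasible x v ν} ∧
      IsMinOn (S.OCPCost x v) {ν | S.OCPFeasible x v ν} μ :=
  Iff.rfl

namespace RegulatorAssumptions

theorem deviationCost_nonneg (hS : S.RegulatorAssumptions) (p : S.Plan) :
    0 ≤ S.deviationCost p :=
  Finset.sum_nonneg fun _ _ => wsq_nonneg hS.lqrWeight_posDef.posSemidef _

theorem deviationCost_add_le (hS : S.RegulatorAssumptions) {θ : ℝ} (hθ : 0 < θ)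
    (p q : S.Plan) :
    S.deviationCost (p + q) ≤ (1 + θ) * S.deviationCost p + (1 + 1 / θ) * S.deviationCost q := by
  simp only [deviationCost, Finset.mul_sum, ← Finset.sum_add_distrib, map_add]
  exact Finset.sum_le_sum fun i _ => wsq_add_le hS.lqrWeight_posDef.posSemidef hθ _ _

theorem cost_eq (hS : S.RegulatorAssumptions) (x : Fin nx → ℝ) (v : Fin nz → ℝ)
    (μ : Fin S.N → Fin nu → ℝ) :
    S.OCPCost x v μ = wsq S.P (x - S.Gx *ᵥ v) + S.deviationCost ((x, v), μ) := by
  let V (i : ℕ) : ℝ := wsq S.P (S.pred x μ i - S.Gx *ᵥ v)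
  have h_stage (i : Fin S.N) :
      wsq S.Q (S.pred x μ i - S.Gx *ᵥ v) + wsq S.R (μ i - S.Gu *ᵥ v) =
        wsq S.lqrWeight (S.lqrDeviation i ((x, v), μ)) + (V i - V (i + 1)) := by
    have h_dev : S.lqrDeviation i ((x, v), μ) =
        (μ i - S.Gu *ᵥ v) + S.K *ᵥ (S.pred x μ i - S.Gx *ᵥ v) := by
      rw [lqrDeviation_apply, termInput]
      abel
    have h := hS.bellman_eq (S.pred x μ i - S.Gx *ᵥ v) (μ i - S.Gu *ᵥ v)
    rw [← hS.step_sub, ← S.pred_succ, ← h_dev] at h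
    linarith
  have h_telescope : ∑ i : Fin S.N, (V i - V (i + 1)) = V 0 - V S.N := by
    rw [Fin.sum_univ_eq_sum_range fun i => V i - V (i + 1)]
    exact Finset.sum_range_sub' V S.N
  have h_init : V 0 = wsq S.P (x - S.Gx *ᵥ v) := rfl
  rw [OCPCost, Finset.sum_congr rfl fun i _ => h_stage i, Finset.sum_add_distrib, h_telescope,
    h_init, deviationCost]
  ring

theorem sum_wsq_input_le_cost (hS : S.RegulatorAssumptions) (x : Fin nx → ℝ)
    (v : Fin nz → ℝ) (μ : Fin S.N → Fin nu → ℝ) :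
    ∑ i, wsq S.R (μ i - S.Gu *ᵥ v) ≤ S.OCPCost x v μ := by
  rw [OCPCost, Finset.sum_add_distrib]
  have h_term := wsq_nonneg hS.riccati.1 (S.pred x μ S.N - S.Gx *ᵥ v)
  have h_state : 0 ≤ ∑ i : Fin S.N, wsq S.Q (S.pred x μ i - S.Gx *ᵥ v) :=
    Finset.sum_nonneg fun i _ => wsq_nonneg hS.Q_posSemidef _
  linarith

theorem sum_wsq_input_pos (hS : S.RegulatorAssumptions) {μ : Fin S.N → Fin nu → ℝ}
    (hμ : μ ≠ 0) : 0 < ∑ i, wsq S.R (μ i) := by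
  obtain ⟨i, hi⟩ := Function.ne_iff.1 hμ
  exact Finset.sum_pos' (fun i _ => wsq_nonneg hS.R_posDef.posSemidef _)
    ⟨i, Finset.mem_univ _, wsq_pos hS.R_posDef hi⟩

theorem deviationCost_pos (hS : S.RegulatorAssumptions) {μ : Fin S.N → Fin nu → ℝ}
    (hμ : μ ≠ 0) : 0 < S.deviationCost (0, μ) := by
  have h_cost := hS.cost_eq 0 0 μ
  have h_input := hS.sum_wsq_input_le_cost 0 0 μ
  simp only [mulVec_zero, sub_zero, wsq_zero, zero_add, Prod.mk_zero_zero] at h_cost h_input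
  linarith [hS.sum_wsq_input_pos hμ]

theorem strictConvexOn_cost (hS : S.RegulatorAssumptions) (x : Fin nx → ℝ)
    (v : Fin nz → ℝ) : StrictConvexOn ℝ univ (S.OCPCost x v) := by
  refine strictConvexOn_of_defect (g := fun μ => S.deviationCost (0, μ))
    (fun μ ν a b hab => ?_) fun μ => hS.deviationCost_pos
  have h_sub : ((0, μ - ν) : S.Plan) = ((x, v), μ) - ((x, v), ν) := by
    rw [Prod.mk_sub_mk, sub_self]
  rw [hS.cost_eq, hS.cost_eq, hS.cost_eq, ← combo_mk _ _ _ hab, h_sub,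
    deviationCost_combo S _ _ hab]
  linear_combination (-wsq S.P (x - S.Gx *ᵥ v)) * hab

theorem continuous_cost (hS : S.RegulatorAssumptions) (x : Fin nx → ℝ) (v : Fin nz → ℝ) :
    Continuous (S.OCPCost x v) := by
  simp only [funext (hS.cost_eq x v)]
  exact continuous_const.add (S.continuous_deviationCost.comp (by fun_prop))

theorem tendsto_cost_cocompact (hS : S.RegulatorAssumptions) (x : Fin nx → ℝ)
    (v : Fin nz → ℝ) : Tendsto (S.OCPCost x v) (cocompact _) atTop := by
  obtain ⟨c, hc, h_lower⟩ := exists_mul_sq_norm_le_of_homogeneous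
    (f := fun μ : Fin S.N → Fin nu → ℝ => ∑ i, wsq S.R (μ i))
    (continuous_finsetSum _ fun i _ => (continuous_wsq _).comp (continuous_apply i))
    (fun c μ => by simp only [Pi.smul_apply, wsq_smul, Finset.mul_sum])
    fun μ => hS.sum_wsq_input_pos
  exact tendsto_cocompact_atTop_of_mul_sq_norm_le (x₀ := fun _ => S.Gu *ᵥ v) hc
    fun μ => (h_lower _).trans (hS.sum_wsq_input_le_cost x v μ)

theorem existsUnique_isOCPMinimizer (hS : S.RegulatorAssumptions)
    (h_closed : IsClosed S.feasiblePlans) (h_conv : Convex ℝ S.feasiblePlans)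
    {x : Fin nx → ℝ} {v : Fin nz → ℝ} (hxv : (x, v) ∈ S.Γ) : ∃! μ, S.IsOCPMinimizer x v μ := by
  simp only [isOCPMinimizer_iff]
  exact existsUnique_isMinOn (h_closed.preimage (Continuous.prodMk_right (x, v))) hxv
    (hS.continuous_cost x v).continuousOn
    ((hS.strictConvexOn_cost x v).subset (subset_univ _) (convex_prodMk_preimage h_conv (x, v)))
    (hS.tendsto_cost_cocompact x v)

end RegulatorAssumptions

end Data

/-! ### Polyhedrality of the feasible sets -/

namespace Data

variable {nx nu ny nz nc : ℕ} (S : Data nx nu ny nz nc)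

/-- The regulator assumptions together with those on the constraint set: `Y` is compact, contains a
neighbourhood of the origin, and is strictly tightened for the references. -/
structure StandingAssumptions : Prop extends S.RegulatorAssumptions where
  eps_mem : S.ε ∈ Ioo (0 : ℝ) 1
  isCompact_Y : IsCompact S.Y
  zero_mem_interior_Y : (0 : Fin ny → ℝ) ∈ interior S.Y

/-- The matrix taking a reference to its steady-state output. -/
def steadyOutput : Matrix (Fin ny) (Fin nz) ℝ := S.C * S.Gx + S.D * S.Gu

/-- The output matrix under the terminal law. -/
noncomputable def closedOutput : Matrix (Fin ny) (Fin nx) ℝ := S.C - S.D * S.K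

theorem termOut_eq_steadyOutput_add (v : Fin nz → ℝ) (x : Fin nx → ℝ) :
    S.termOut v x = S.steadyOutput *ᵥ v + S.closedOutput *ᵥ (x - S.Gx *ᵥ v) := by
  simp only [termOut, steadyOutput, closedOutput, add_mulVec, sub_mulVec, mulVec_sub, mulVec_add,
    ← mulVec_mulVec]
  abel

theorem isPolyhedral_Y : IsPolyhedral S.Y := by
  refine ⟨range fun i => (ContinuousLinearMap.proj (φ := fun _ => ℝ) i ∘L mulVecCLM S.Yc, S.h i),
    finite_range _, ?_⟩
  ext y
  simp only [mem_ofPred_eq, forall_mem_range]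
  rfl

variable {S}

theorem mem_Reps_of_mem_Γ {x : Fin nx → ℝ} {v : Fin nz → ℝ} (hxv : (x, v) ∈ S.Γ) :
    v ∈ S.Reps :=
  let ⟨_, hμ⟩ := hxv
  hμ.2.1

variable (S) in
theorem fst_image_Λ : Prod.fst '' S.Λ = {x | ∃ v, (x, v) ∈ S.Γ} := by
  ext x
  constructor
  · rintro ⟨⟨x, v⟩, hxv, rfl⟩
    exact ⟨v, hxv.1⟩
  · rintro ⟨v, hxv⟩
    exact ⟨(x, v), ⟨hxv, mem_univ _, mem_Reps_of_mem_Γ hxv⟩, rfl⟩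

namespace StandingAssumptions

theorem one_sub_eps_pos (hS : S.StandingAssumptions) : 0 < 1 - S.ε := sub_pos.2 hS.eps_mem.2

theorem mem_Reps_iff (hS : S.StandingAssumptions) (v : Fin nz → ℝ) :
    v ∈ S.Reps ↔ (1 - S.ε)⁻¹ • (S.steadyOutput *ᵥ v) ∈ S.Y :=
  mem_smul_set_iff_inv_smul_mem₀ hS.one_sub_eps_pos.ne' _ _

theorem isPolyhedral_Reps (hS : S.StandingAssumptions) : IsPolyhedral S.Reps := by
  convert S.isPolyhedral_Y.preimage ((1 - S.ε)⁻¹ • mulVecCLM S.steadyOutput) using 1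
  ext v
  exact hS.mem_Reps_iff v

theorem zero_mem_Reps (hS : S.StandingAssumptions) : (0 : Fin nz → ℝ) ∈ S.Reps := by
  rw [hS.mem_Reps_iff, mulVec_zero, smul_zero]
  exact interior_subset hS.zero_mem_interior_Y

theorem exists_margin (hS : S.StandingAssumptions) :
    ∃ η : ℝ, 0 < η ∧ ∀ v ∈ S.Reps, ∀ z, ‖z‖ ≤ η → S.steadyOutput *ᵥ v + z ∈ S.Y := by
  obtain ⟨δ, hδ, h_ball⟩ := Metric.nhds_basis_closedBall.mem_iff.1
    (mem_interior_iff_mem_nhds.1 hS.zero_mem_interior_Y)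
  have hε := hS.eps_mem.1
  refine ⟨S.ε * δ, by positivity, fun v hv z hz => ?_⟩
  have hz_mem : S.ε⁻¹ • z ∈ S.Y := by
    refine h_ball ?_
    rwa [mem_closedBall_zero_iff, norm_smul, norm_inv, Real.norm_of_nonneg hε.le,
      inv_mul_le_iff₀ hε]
  have h_combo := S.isPolyhedral_Y.convex ((hS.mem_Reps_iff v).1 hv) hz_mem
    hS.one_sub_eps_pos.le hε.le (sub_add_cancel 1 S.ε)
  rwa [smul_inv_smul₀ hS.one_sub_eps_pos.ne', smul_inv_smul₀ hε.ne'] at h_combo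

theorem exists_norm_le_of_steadyOutput_add_mem_Y (hS : S.StandingAssumptions) :
    ∃ M : ℝ, 0 ≤ M ∧ ∀ v ∈ S.Reps, ∀ z, S.steadyOutput *ᵥ v + z ∈ S.Y → ‖z‖ ≤ M := by
  obtain ⟨M, hM_pos, hM⟩ := hS.isCompact_Y.isBounded.exists_pos_norm_le
  have hε := hS.one_sub_eps_pos
  refine ⟨M + (1 - S.ε) * M, by positivity, fun v hv z hz => ?_⟩
  have hv_le := hM _ ((hS.mem_Reps_iff v).1 hv)
  rw [norm_smul, norm_inv, Real.norm_of_nonneg hε.le, inv_mul_le_iff₀ hε] at hv_le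
  calc ‖z‖ = ‖(S.steadyOutput *ᵥ v + z) - S.steadyOutput *ᵥ v‖ := by rw [add_sub_cancel_left]
    _ ≤ M + (1 - S.ε) * M := (norm_sub_le _ _).trans (add_le_add (hM _ hz) hv_le)

theorem mem_T_iff (hS : S.StandingAssumptions) (x : Fin nx → ℝ) (v : Fin nz → ℝ) :
    (x, v) ∈ S.T ↔ v ∈ S.Reps ∧ ∀ i : ℕ, S.steadyOutput *ᵥ v +
      mulVecCLM (S.closedOutput * S.closedMatrix ^ i) (x - S.Gx *ᵥ v) ∈ S.Y := by
  simp only [T, mem_ofPred_eq, termOut_eq_steadyOutput_add, hS.iterate_termStep_sub,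
    mulVecCLM_apply, mulVec_mulVec]

theorem exists_mem_T_of_close (hS : S.StandingAssumptions) :
    ∃ η : ℝ, 0 < η ∧ ∀ v ∈ S.Reps, ∀ x, ‖x - S.Gx *ᵥ v‖ ≤ η → (x, v) ∈ S.T := by
  obtain ⟨δ, hδ, h_margin⟩ := hS.exists_margin
  obtain ⟨C, hC⟩ := (hS.isSchur_closedMatrix.tendsto_comp_pow S.closedOutput).norm.bddAbove_range
  have hC_pos : 0 < max C 1 := by positivity
  refine ⟨δ / max C 1, by positivity, fun v hv x hx =>
    (hS.mem_T_iff x v).2 ⟨hv, fun i => h_margin v hv _ ?_⟩⟩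
  calc _ ≤ max C 1 * (δ / max C 1) := ContinuousLinearMap.le_of_opNorm_le_of_le _
        ((hC ⟨i, rfl⟩).trans (le_max_left _ _)) hx
    _ = δ := mul_div_cancel₀ _ hC_pos.ne'

theorem steadyState_mem_T (hS : S.StandingAssumptions) {v : Fin nz → ℝ} (hv : v ∈ S.Reps) :
    (S.Gx *ᵥ v, v) ∈ S.T := by
  obtain ⟨η, hη, h_close⟩ := hS.exists_mem_T_of_close
  exact h_close v hv _ (by rw [sub_self, norm_zero]; exact hη.le)

/- Outputs admissible up to some fixed time `J` are so forever: they deviate from the steady state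
by a bounded amount up to `J`, and the terminal law contracts this below the margin left by the
tightening `ε`. -/
theorem exists_mem_T_iff_forall_lt (hS : S.StandingAssumptions) :
    ∃ J : ℕ, ∀ x v, (x, v) ∈ S.T ↔ v ∈ S.Reps ∧ ∀ i : Fin J, S.steadyOutput *ᵥ v +
      mulVecCLM (S.closedOutput * S.closedMatrix ^ (i : ℕ)) (x - S.Gx *ᵥ v) ∈ S.Y := by
  obtain ⟨δ, hδ, h_margin⟩ := hS.exists_margin
  obtain ⟨M, hM_nonneg, hM⟩ := hS.exists_norm_le_of_steadyOutput_add_mem_Y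
  obtain ⟨J, hJ⟩ := exists_norm_apply_le_of_forall_lt
    (hS.isSchur_closedMatrix.tendsto_comp_pow S.closedOutput) hM_nonneg hδ
  refine ⟨J, fun x v => (hS.mem_T_iff x v).trans
    (and_congr_right fun hv => ⟨fun h i => h i, fun h i => ?_⟩)⟩
  rcases lt_or_ge i J with hi | hi
  · exact h ⟨i, hi⟩
  · exact h_margin v hv _ (hJ _ (fun j hj => hM v hv _ (h ⟨j, hj⟩)) i hi)

theorem isPolyhedral_T (hS : S.StandingAssumptions) : IsPolyhedral S.T := by
  obtain ⟨J, hJ⟩ := hS.exists_mem_T_iff_forall_lt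
  let π₁ := ContinuousLinearMap.fst ℝ (Fin nx → ℝ) (Fin nz → ℝ)
  let π₂ := ContinuousLinearMap.snd ℝ (Fin nx → ℝ) (Fin nz → ℝ)
  convert (hS.isPolyhedral_Reps.preimage π₂).inter
    (isPolyhedral_iInter fun i : Fin J => S.isPolyhedral_Y.preimage
      (mulVecCLM S.steadyOutput ∘L π₂ +
        mulVecCLM (S.closedOutput * S.closedMatrix ^ (i : ℕ)) ∘L
          (π₁ - mulVecCLM S.Gx ∘L π₂))) using 1
  ext ⟨x, v⟩
  rw [hJ, mem_inter_iff, mem_iInter]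
  rfl

theorem isPolyhedral_feasiblePlans (hS : S.StandingAssumptions) :
    IsPolyhedral S.feasiblePlans := by
  let π₁ := ContinuousLinearMap.fst ℝ ((Fin nx → ℝ) × (Fin nz → ℝ)) (Fin S.N → Fin nu → ℝ)
  let π₂ := ContinuousLinearMap.snd ℝ ((Fin nx → ℝ) × (Fin nz → ℝ)) (Fin S.N → Fin nu → ℝ)
  convert (isPolyhedral_iInter fun i : Fin S.N => S.isPolyhedral_Y.preimage
    (mulVecCLM S.C ∘L S.predMap i + mulVecCLM S.D ∘L
      ContinuousLinearMap.proj (φ := fun _ => Fin nu → ℝ) i ∘L π₂)).inter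
    (hS.isPolyhedral_T.preimage
      ((S.predMap S.N).prod (ContinuousLinearMap.snd ℝ _ _ ∘L π₁))) using 1
  ext p
  simp only [feasiblePlans, OCPFeasible, mem_ofPred_eq, ← predMap_apply, mem_inter_iff, mem_iInter]
  rfl

theorem isPolyhedral_Γ (hS : S.StandingAssumptions) : IsPolyhedral S.Γ := by
  have h_image : S.Γ = Prod.fst '' S.feasiblePlans := by
    ext ⟨x, v⟩
    simp [Γ, feasiblePlans]
  rw [h_image]
  exact hS.isPolyhedral_feasiblePlans.image_fst

theorem exists_lipschitz_feasible (hS : S.StandingAssumptions) :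
    ∃ L : ℝ, 0 ≤ L ∧ ∀ x v μ, S.OCPFeasible x v μ → ∀ x' v', (x', v') ∈ S.Γ →
      ∃ μ', S.OCPFeasible x' v' μ' ∧ ‖μ' - μ‖ ≤ L * ‖(x', v') - (x, v)‖ := by
  obtain ⟨L, hL, h⟩ := hS.isPolyhedral_feasiblePlans.exists_lipschitz_fibers
  refine ⟨L, hL, fun x v μ hμ x' v' ⟨ν, hν⟩ => h (x, v) μ hμ (x', v') ⟨((x', v'), ν), hν, rfl⟩⟩

theorem existsUnique_isOCPMinimizer (hS : S.StandingAssumptions) {x : Fin nx → ℝ}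
    {v : Fin nz → ℝ} (hxv : (x, v) ∈ S.Γ) : ∃! μ, S.IsOCPMinimizer x v μ :=
  hS.toRegulatorAssumptions.existsUnique_isOCPMinimizer hS.isPolyhedral_feasiblePlans.isClosed
    hS.isPolyhedral_feasiblePlans.convex hxv

end StandingAssumptions

/-! ### The governor -/

theorem isGovernorOutput_iff {r v : Fin nz → ℝ} {x : Fin nx → ℝ} :
    S.IsGovernorOutput r x v ↔ v ∈ Prod.mk x ⁻¹' S.Γ ∧
      IsMinOn (fun w => nsq (w - r)) (Prod.mk x ⁻¹' S.Γ) v :=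
  ⟨fun h => ⟨h.1.2, fun w hw => h.2 w (mem_Reps_of_mem_Γ hw) hw⟩,
    fun h => ⟨⟨mem_Reps_of_mem_Γ h.1, h.1⟩, fun _ _ hw => h.2 hw⟩⟩

namespace StandingAssumptions

theorem existsUnique_isGovernorOutput (hS : S.StandingAssumptions) (r : Fin nz → ℝ)
    {x : Fin nx → ℝ} (hx : ∃ v, (x, v) ∈ S.Γ) : ∃! v, S.IsGovernorOutput r x v := by
  simp only [isGovernorOutput_iff]
  exact existsUnique_nearest (hS.isPolyhedral_Γ.isClosed.preimage (Continuous.prodMk_right x))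
    (convex_prodMk_preimage hS.isPolyhedral_Γ.convex x) hx r

theorem existsUnique_isProjection (hS : S.StandingAssumptions) (r : Fin nz → ℝ) :
    ∃! v, S.IsProjection r v :=
  existsUnique_nearest hS.isPolyhedral_Reps.isClosed hS.isPolyhedral_Reps.convex
    ⟨0, hS.zero_mem_Reps⟩ r

theorem nsq_sub_le_of_isGovernorOutput (hS : S.StandingAssumptions) {r v w : Fin nz → ℝ}
    {x : Fin nx → ℝ} (hv : S.IsGovernorOutput r x v) (hw : (x, w) ∈ S.Γ) :
    nsq (v - w) ≤ 2 * (nsq (w - r) - nsq (v - r)) :=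
  have hv' := isGovernorOutput_iff.1 hv
  nsq_sub_le_of_isMinOn (convex_prodMk_preimage hS.isPolyhedral_Γ.convex x) hv'.1 hv'.2 hw

theorem eq_of_isGovernorOutput_of_mem_Γ (hS : S.StandingAssumptions) {r rs v : Fin nz → ℝ}
    {x : Fin nx → ℝ} (hrs : S.IsProjection r rs) (hv : S.IsGovernorOutput r x v)
    (h_mem : (x, rs) ∈ S.Γ) : v = rs :=
  (hS.existsUnique_isGovernorOutput r ⟨rs, h_mem⟩).unique hv
    ⟨⟨hrs.1, h_mem⟩, fun w hw _ => hrs.2 w hw⟩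

end StandingAssumptions

end Data

/-! ### The terminal law and the shifted plan -/

theorem sum_add_eq_sum_of_shift {n : ℕ} {f g : Fin n → ℝ} (hn : 0 < n)
    (h_lt : ∀ i (hi : i + 1 < n), g ⟨i, (Nat.lt_succ_self i).trans hi⟩ = f ⟨i + 1, hi⟩)
    (h_last : ∀ i : Fin n, (i : ℕ) + 1 = n → g i = 0) :
    ∑ i, g i + f ⟨0, hn⟩ = ∑ i, f i := by
  obtain ⟨m, rfl⟩ := Nat.exists_eq_add_one.2 hn
  rw [Fin.sum_univ_succ f, Fin.sum_univ_castSucc, h_last (Fin.last m) rfl, add_zero, add_comm]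
  exact congrArg₂ _ rfl (Finset.sum_congr rfl fun i _ => h_lt i (Nat.succ_lt_succ i.2))

namespace Data

variable {nx nu ny nz nc : ℕ} (S : Data nx nu ny nz nc)

theorem termStep_mem_T {x : Fin nx → ℝ} {v : Fin nz → ℝ} (hxv : (x, v) ∈ S.T) :
    (S.termStep v x, v) ∈ S.T :=
  ⟨hxv.1, fun i => by simpa only [Function.iterate_succ_apply] using hxv.2 (i + 1)⟩

theorem iterate_termStep_mem_T {x : Fin nx → ℝ} {v : Fin nz → ℝ} (hxv : (x, v) ∈ S.T) (i : ℕ) :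
    ((S.termStep v)^[i] x, v) ∈ S.T := by
  induction i with
  | zero => exact hxv
  | succ i ih =>
    rw [Function.iterate_succ_apply']
    exact S.termStep_mem_T ih

/-- The input sequence generated by the terminal law from the state `x`. -/
noncomputable def termInputs (v : Fin nz → ℝ) (x : Fin nx → ℝ) : Fin S.N → Fin nu → ℝ :=
  fun i => S.termInput v ((S.termStep v)^[i] x)

theorem pred_termInputs (v : Fin nz → ℝ) (x : Fin nx → ℝ) {i : ℕ} (hi : i ≤ S.N) :
    S.pred x (S.termInputs v x) i = (S.termStep v)^[i] x := by
  induction i with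
  | zero => rfl
  | succ i ih =>
    rw [S.pred_succ x _ ⟨i, hi⟩, ih (Nat.le_of_succ_le hi), Function.iterate_succ_apply',
      termStep_eq]
    rfl

theorem ocpFeasible_termInputs {x : Fin nx → ℝ} {v : Fin nz → ℝ} (hxv : (x, v) ∈ S.T) :
    S.OCPFeasible x v (S.termInputs v x) := by
  refine ⟨fun i => ?_, ?_⟩
  · rw [pred_termInputs S v x i.2.le, termInputs, ← termOut_eq]
    exact hxv.2 i
  · rw [pred_termInputs S v x le_rfl]
    exact S.iterate_termStep_mem_T hxv _

theorem deviationCost_termInputs (v : Fin nz → ℝ) (x : Fin nx → ℝ) :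
    S.deviationCost ((x, v), S.termInputs v x) = 0 := by
  refine Finset.sum_eq_zero fun i _ => ?_
  rw [lqrDeviation_apply, pred_termInputs S v x i.2.le, termInputs, sub_self, wsq_zero]

theorem mem_Γ_of_mem_T {x : Fin nx → ℝ} {v : Fin nz → ℝ} (hxv : (x, v) ∈ S.T) :
    (x, v) ∈ S.Γ :=
  ⟨_, S.ocpFeasible_termInputs hxv⟩

/-- The state reached by applying the first input of `μ`. -/
def nextState (x : Fin nx → ℝ) (μ : Fin S.N → Fin nu → ℝ) : Fin nx → ℝ :=
  S.A *ᵥ x + S.B *ᵥ μ ⟨0, S.N_pos⟩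

/-- The input sequence `μ` without its first entry, extended by the terminal law at the predicted
state `ξ_N`. -/
noncomputable def shiftInputs (x : Fin nx → ℝ) (v : Fin nz → ℝ) (μ : Fin S.N → Fin nu → ℝ) :
    Fin S.N → Fin nu → ℝ :=
  fun i => if hi : i + 1 < S.N then μ ⟨i + 1, hi⟩ else S.termInput v (S.pred x μ S.N)

section Shift

variable (x : Fin nx → ℝ) (v : Fin nz → ℝ) (μ : Fin S.N → Fin nu → ℝ)

theorem shiftInputs_of_lt {i : ℕ} (hi : i + 1 < S.N) :
    S.shiftInputs x v μ ⟨i, (Nat.lt_succ_self i).trans hi⟩ = μ ⟨i + 1, hi⟩ :=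
  dif_pos hi

theorem shiftInputs_of_eq {i : Fin S.N} (hi : (i : ℕ) + 1 = S.N) :
    S.shiftInputs x v μ i = S.termInput v (S.pred x μ S.N) :=
  dif_neg hi.not_lt

theorem pred_shiftInputs {i : ℕ} (hi : i < S.N) :
    S.pred (S.nextState x μ) (S.shiftInputs x v μ) i = S.pred x μ (i + 1) := by
  induction i with
  | zero => exact (S.pred_succ x μ ⟨0, S.N_pos⟩).symm
  | succ i ih =>
    have hi' : i < S.N := (Nat.lt_succ_self i).trans hi
    rw [S.pred_succ _ _ ⟨i, hi'⟩, ih hi', S.pred_succ x μ ⟨i + 1, hi⟩, shiftInputs_of_lt S x v μ hi]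

theorem pred_shiftInputs_horizon :
    S.pred (S.nextState x μ) (S.shiftInputs x v μ) S.N = S.termStep v (S.pred x μ S.N) := by
  obtain ⟨i, hi⟩ : ∃ i : Fin S.N, (i : ℕ) + 1 = S.N :=
    ⟨⟨S.N - 1, Nat.sub_lt S.N_pos one_pos⟩, Nat.sub_add_cancel S.N_pos⟩
  have h_last := S.pred_succ (S.nextState x μ) (S.shiftInputs x v μ) i
  rwa [pred_shiftInputs S x v μ i.2, shiftInputs_of_eq S x v μ hi, hi, ← termStep_eq] at h_last

variable {x v μ}

theorem ocpFeasible_shiftInputs (hμ : S.OCPFeasible x v μ) :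
    S.OCPFeasible (S.nextState x μ) v (S.shiftInputs x v μ) := by
  refine ⟨fun i => ?_, ?_⟩
  · rw [pred_shiftInputs S x v μ i.2]
    rcases (Nat.succ_le_of_lt i.2).lt_or_eq with hi | hi
    · rw [shiftInputs_of_lt S x v μ hi]
      exact hμ.1 ⟨i + 1, hi⟩
    · rw [shiftInputs_of_eq S x v μ hi, show (i : ℕ) + 1 = S.N from hi, ← termOut_eq]
      exact hμ.2.2 0
  · rw [pred_shiftInputs_horizon]
    exact S.termStep_mem_T hμ.2

end Shift

theorem deviationCost_shiftInputs (x : Fin nx → ℝ) (v : Fin nz → ℝ)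
    (μ : Fin S.N → Fin nu → ℝ) :
    S.deviationCost ((S.nextState x μ, v), S.shiftInputs x v μ) +
        wsq S.lqrWeight (S.lqrDeviation ⟨0, S.N_pos⟩ ((x, v), μ)) =
      S.deviationCost ((x, v), μ) := by
  refine sum_add_eq_sum_of_shift (f := fun i => wsq S.lqrWeight (S.lqrDeviation i ((x, v), μ)))
    S.N_pos (fun i hi => ?_) fun i hi => ?_
  · rw [lqrDeviation_apply, lqrDeviation_apply,
      pred_shiftInputs S x v μ ((Nat.lt_succ_self i).trans hi), shiftInputs_of_lt S x v μ hi]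
  · rw [lqrDeviation_apply, pred_shiftInputs S x v μ i.2, hi, shiftInputs_of_eq S x v μ hi,
      sub_self, wsq_zero]

variable {S}

/-! ### Bounds on the deviation cost of minimizers -/

theorem RegulatorAssumptions.deviationCost_le_of_isOCPMinimizer (hS : S.RegulatorAssumptions)
    {x : Fin nx → ℝ} {v : Fin nz → ℝ} {μ ν : Fin S.N → Fin nu → ℝ}
    (hμ : S.IsOCPMinimizer x v μ) (hν : S.OCPFeasible x v ν) :
    S.deviationCost ((x, v), μ) ≤ S.deviationCost ((x, v), ν) := by
  have h := hμ.2 ν hν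
  rwa [hS.cost_eq, hS.cost_eq, add_le_add_iff_left] at h

namespace StandingAssumptions

theorem exists_deviationCost_perturbation (hS : S.StandingAssumptions) :
    ∃ L : ℝ, 0 ≤ L ∧ ∀ x v μ, S.OCPFeasible x v μ → ∀ x' v' μ', S.IsOCPMinimizer x' v' μ' →
      ∀ θ : ℝ, 0 < θ → S.deviationCost ((x', v'), μ') ≤
        (1 + θ) * S.deviationCost ((x, v), μ) +
          (1 + 1 / θ) * (L * ‖(x', v') - (x, v)‖ ^ 2) := by
  obtain ⟨L, hL, h_lip⟩ := hS.exists_lipschitz_feasible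
  obtain ⟨C, hC, h_quad⟩ :=
    exists_le_mul_sq_norm_of_homogeneous S.continuous_deviationCost S.deviationCost_smul
  refine ⟨C * (1 + L) ^ 2, by positivity, fun x v μ hμ x' v' μ' hμ' θ hθ => ?_⟩
  obtain ⟨ν, hν, hν_le⟩ := h_lip x v μ hμ x' v' ⟨μ', hμ'.1⟩
  let d : S.Plan := ((x', v') - (x, v), ν - μ)
  have h_add : (((x', v'), ν) : S.Plan) = ((x, v), μ) + d := by simp [d]
  have h_norm : ‖d‖ ≤ (1 + L) * ‖(x', v') - (x, v)‖ := by
    have h_nonneg := norm_nonneg ((x', v') - (x, v))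
    exact max_le (by nlinarith) (hν_le.trans (by nlinarith))
  have h_dev : S.deviationCost d ≤ C * (1 + L) ^ 2 * ‖(x', v') - (x, v)‖ ^ 2 :=
    calc S.deviationCost d ≤ C * ‖d‖ ^ 2 := h_quad d
      _ ≤ C * ((1 + L) * ‖(x', v') - (x, v)‖) ^ 2 := by gcongr
      _ = C * (1 + L) ^ 2 * ‖(x', v') - (x, v)‖ ^ 2 := by ring
  calc S.deviationCost ((x', v'), μ')
      ≤ S.deviationCost (((x, v), μ) + d) :=
        h_add ▸ hS.deviationCost_le_of_isOCPMinimizer hμ' hν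
    _ ≤ (1 + θ) * S.deviationCost ((x, v), μ) + (1 + 1 / θ) * S.deviationCost d :=
        hS.deviationCost_add_le hθ _ _
    _ ≤ _ := by gcongr

theorem exists_deviationCost_le_mul_sq_norm (hS : S.StandingAssumptions) :
    ∃ L : ℝ, 0 ≤ L ∧ ∀ x v μ, S.IsOCPMinimizer x v μ →
      S.deviationCost ((x, v), μ) ≤ L * ‖x - S.Gx *ᵥ v‖ ^ 2 := by
  obtain ⟨L, hL, h_pert⟩ := hS.exists_deviationCost_perturbation
  refine ⟨2 * L, by positivity, fun x v μ hμ => ?_⟩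
  have h_steady := S.ocpFeasible_termInputs (hS.steadyState_mem_T hμ.1.2.1)
  have h_norm : ‖(x, v) - (S.Gx *ᵥ v, v)‖ = ‖x - S.Gx *ᵥ v‖ := by simp [Prod.norm_def]
  have h := h_pert _ _ _ h_steady x v μ hμ 1 one_pos
  rw [deviationCost_termInputs, h_norm] at h
  linarith

theorem exists_deviationCost_next_le (hS : S.StandingAssumptions) :
    ∃ L : ℝ, 0 ≤ L ∧ ∀ x v μ v' μ', S.OCPFeasible x v μ →
      S.IsOCPMinimizer (S.nextState x μ) v' μ' → ∀ θ : ℝ, 0 < θ →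
      S.deviationCost ((S.nextState x μ, v'), μ') ≤
        (1 + θ) * (S.deviationCost ((x, v), μ) -
          wsq S.lqrWeight (S.lqrDeviation ⟨0, S.N_pos⟩ ((x, v), μ))) +
        (1 + 1 / θ) * (L * ‖v' - v‖ ^ 2) := by
  obtain ⟨L, hL, h_pert⟩ := hS.exists_deviationCost_perturbation
  refine ⟨L, hL, fun x v μ v' μ' hμ hμ' θ hθ => ?_⟩
  have h_norm : ‖(S.nextState x μ, v') - (S.nextState x μ, v)‖ = ‖v' - v‖ := by
    simp [Prod.norm_def]
  have h := h_pert _ v _ (S.ocpFeasible_shiftInputs hμ) _ v' μ' hμ' θ hθ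
  rwa [h_norm, eq_sub_of_add_eq (S.deviationCost_shiftInputs x v μ)] at h

end StandingAssumptions

end Data

/-! ### A Lyapunov function for changes of the reference -/

theorem sq_add_le_young {θ : ℝ} (hθ : 0 < θ) (a b : ℝ) :
    (a + b) ^ 2 ≤ (1 + θ) * a ^ 2 + (1 + 1 / θ) * b ^ 2 := by
  have h_sq : 0 ≤ (1 / θ) * (θ * a - b) ^ 2 := by positivity
  have h_expand : (1 + θ) * a ^ 2 + (1 + 1 / θ) * b ^ 2 - (a + b) ^ 2
      = (1 / θ) * (θ * a - b) ^ 2 := by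
    field_simp
    ring
  linarith

theorem sq_mul_add_le {c : ℝ} (hc0 : 0 < c) (hc1 : c < 1) (a b : ℝ) :
    (c * a + b) ^ 2 ≤ c * a ^ 2 + b ^ 2 / (1 - c) := by
  have hc : 0 < 1 - c := sub_pos.2 hc1
  have h_sq : 0 ≤ c / (1 - c) * ((1 - c) * a - b) ^ 2 := by positivity
  have h_expand : c * a ^ 2 + b ^ 2 / (1 - c) - (c * a + b) ^ 2
      = c / (1 - c) * ((1 - c) * a - b) ^ 2 := by
    field_simp
    ring
  linarith

/- The weight `γ` makes the decrease `σ` of the cost `w` pay for the disturbance `s` of the error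
`a`. -/
theorem exists_sq_add_mul_contraction {c m L : ℝ} (b : ℝ) (hc0 : 0 < c) (hc1 : c < 1)
    (hm : 0 < m) (hL : 0 ≤ L) :
    ∃ γ κ : ℝ, 0 ≤ γ ∧ 0 < κ ∧ ∀ a s σ w : ℝ, m * s ^ 2 ≤ σ → w ≤ L * a ^ 2 →
      (c * a + b * s) ^ 2 + γ * (w - σ) ≤ (1 - κ) * (a ^ 2 + γ * w) := by
  have hc : 0 < 1 - c := sub_pos.2 hc1
  let γ := b ^ 2 / (1 - c) / m
  have hγ : 0 ≤ γ := by positivity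
  let κ := (1 - c) / (1 + γ * L)
  have hκ : 0 < κ := div_pos hc (by positivity)
  refine ⟨γ, κ, hγ, hκ, fun a s σ w hσ hw => ?_⟩
  have h_disturbance : (b * s) ^ 2 / (1 - c) ≤ γ * σ :=
    calc (b * s) ^ 2 / (1 - c) = γ * (m * s ^ 2) := by simp only [γ]; field_simp
      _ ≤ γ * σ := by gcongr
  have h_decrease : κ * (a ^ 2 + γ * w) ≤ (1 - c) * a ^ 2 :=
    calc κ * (a ^ 2 + γ * w) ≤ κ * (a ^ 2 + γ * (L * a ^ 2)) := by gcongr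
      _ = (1 - c) * a ^ 2 := by simp only [κ]; field_simp
  linarith [sq_mul_add_le hc0 hc1 a (b * s)]

theorem sq_add_mul_le_of_perturbation {γ κ V a₀ a w₀ w β ω : ℝ} (hγ : 0 ≤ γ) (hκ : 0 < κ)
    (ha : 0 ≤ a) (ha_le : a ≤ a₀ + β) (hw_le : w ≤ (1 + κ) * w₀ + (1 + 1 / κ) * ω)
    (h_nominal : a₀ ^ 2 + γ * w₀ ≤ (1 - κ) * V) :
    a ^ 2 + γ * w ≤ (1 - κ ^ 2) * V + (1 + 1 / κ) * (β ^ 2 + γ * ω) :=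
  calc a ^ 2 + γ * w ≤ (a₀ + β) ^ 2 + γ * ((1 + κ) * w₀ + (1 + 1 / κ) * ω) := by gcongr
    _ ≤ ((1 + κ) * a₀ ^ 2 + (1 + 1 / κ) * β ^ 2) +
          γ * ((1 + κ) * w₀ + (1 + 1 / κ) * ω) := by
        gcongr
        exact sq_add_le_young hκ a₀ β
    _ = (1 + κ) * (a₀ ^ 2 + γ * w₀) + (1 + 1 / κ) * (β ^ 2 + γ * ω) := by ring
    _ ≤ (1 + κ) * ((1 - κ) * V) + (1 + 1 / κ) * (β ^ 2 + γ * ω) := by gcongr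
    _ = (1 - κ ^ 2) * V + (1 + 1 / κ) * (β ^ 2 + γ * ω) := by ring

namespace Data

variable {nx nu ny nz nc : ℕ} {S : Data nx nu ny nz nc}

theorem RegulatorAssumptions.exists_seminorm_next_le (hS : S.RegulatorAssumptions) :
    ∃ (p : Seminorm ℝ (Fin nx → ℝ)) (c b g : ℝ), 0 < c ∧ c < 1 ∧ (∀ x, ‖x‖ ≤ p x) ∧
      ∀ x v μ v', p (S.nextState x μ - S.Gx *ᵥ v') ≤
        c * p (x - S.Gx *ᵥ v) + b * ‖S.lqrDeviation ⟨0, S.N_pos⟩ ((x, v), μ)‖ +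
          g * ‖v' - v‖ := by
  obtain ⟨c, p, C, hc0, hc1, hC, h_lower, h_upper, h_contract⟩ :=
    hS.isSchur_closedMatrix.exists_adapted_seminorm
  have h_bound {k : ℕ} (M : Matrix (Fin nx) (Fin k) ℝ) (y : Fin k → ℝ) :
      p (M *ᵥ y) ≤ C * ‖mulVecCLM M‖ * ‖y‖ := by
    rw [mul_assoc]
    exact (h_upper _).trans (by gcongr; exact (mulVecCLM M).le_opNorm y)
  refine ⟨p, c, C * ‖mulVecCLM S.B‖, C * ‖mulVecCLM S.Gx‖, hc0, hc1, h_lower,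
    fun x v μ v' => ?_⟩
  have h_split : S.nextState x μ - S.Gx *ᵥ v' = (S.closedMatrix *ᵥ (x - S.Gx *ᵥ v) +
      S.B *ᵥ S.lqrDeviation ⟨0, S.N_pos⟩ ((x, v), μ)) + S.Gx *ᵥ (v - v') := by
    rw [lqrDeviation_apply, show S.pred x μ (⟨0, S.N_pos⟩ : Fin S.N) = x from rfl,
      ← hS.step_sub_eq_closedMatrix, nextState, mulVec_sub, sub_add_sub_cancel]
  rw [h_split, norm_sub_rev v' v]
  exact (map_add_le_add p _ _).trans (add_le_add ((map_add_le_add p _ _).trans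
    (add_le_add (h_contract _) (h_bound _ _))) (h_bound _ _))

namespace StandingAssumptions

theorem exists_lyapunov (hS : S.StandingAssumptions) :
    ∃ (V : S.Plan → ℝ) (ρ D : ℝ), ρ < 1 ∧ 0 ≤ D ∧
      (∀ x v μ, ‖x - S.Gx *ᵥ v‖ ^ 2 ≤ V ((x, v), μ)) ∧
      ∀ x v μ v' μ', S.IsOCPMinimizer x v μ → S.IsOCPMinimizer (S.nextState x μ) v' μ' →
        V ((S.nextState x μ, v'), μ') ≤ ρ * V ((x, v), μ) + D * nsq (v' - v) := by
  obtain ⟨p, c, b, g, hc0, hc1, hp_lower, hp_next⟩ := hS.exists_seminorm_next_le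
  obtain ⟨L₁, hL₁, h_cost_le⟩ := hS.exists_deviationCost_le_mul_sq_norm
  obtain ⟨L₂, hL₂, h_cost_next⟩ := hS.exists_deviationCost_next_le
  obtain ⟨m, hm, h_weight⟩ := exists_mul_sq_norm_le_wsq hS.lqrWeight_posDef
  obtain ⟨n, hn, h_nsq⟩ := exists_mul_sq_norm_le_nsq nz
  obtain ⟨γ, κ, hγ, hκ, h_contract⟩ := exists_sq_add_mul_contraction b hc0 hc1 hm hL₁
  refine ⟨fun q => p (q.1.1 - S.Gx *ᵥ q.1.2) ^ 2 + γ * S.deviationCost q, 1 - κ ^ 2,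
    (1 + 1 / κ) * (g ^ 2 + γ * L₂) / n, sub_lt_self 1 (by positivity), by positivity,
    fun x v μ => ?_, fun x v μ v' μ' hμ hμ' => ?_⟩
  · have h_nonneg := mul_nonneg hγ (hS.deviationCost_nonneg ((x, v), μ))
    have h_sq : ‖x - S.Gx *ᵥ v‖ ^ 2 ≤ p (x - S.Gx *ᵥ v) ^ 2 := by
      gcongr
      exact hp_lower _
    exact h_sq.trans (le_add_of_nonneg_right h_nonneg)
  · have h_cost : S.deviationCost ((x, v), μ) ≤ L₁ * p (x - S.Gx *ᵥ v) ^ 2 :=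
      (h_cost_le x v μ hμ).trans (by gcongr; exact hp_lower _)
    have h_reference : ‖v' - v‖ ^ 2 ≤ nsq (v' - v) / n := by
      rw [le_div_iff₀' hn]
      exact h_nsq _
    refine (sq_add_mul_le_of_perturbation hγ hκ (apply_nonneg p _) (hp_next x v μ v')
      (h_cost_next x v μ v' μ' hμ.1 hμ' κ hκ)
      (h_contract _ _ _ _ (h_weight _) h_cost)).trans (add_le_add_right ?_ _)
    calc (1 + 1 / κ) * ((g * ‖v' - v‖) ^ 2 + γ * (L₂ * ‖v' - v‖ ^ 2))
        = (1 + 1 / κ) * (g ^ 2 + γ * L₂) * ‖v' - v‖ ^ 2 := by ring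
      _ ≤ (1 + 1 / κ) * (g ^ 2 + γ * L₂) * (nsq (v' - v) / n) := by gcongr
      _ = (1 + 1 / κ) * (g ^ 2 + γ * L₂) / n * nsq (v' - v) := by ring

/- Close to the steady state of `v`, references near `v` are all feasible, so `v` minimizes the
distance to `r` locally on the convex set `Reps`, hence globally. -/
theorem exists_isProjection_of_isGovernorOutput (hS : S.StandingAssumptions) :
    ∃ η : ℝ, 0 < η ∧ ∀ r x v, S.IsGovernorOutput r x v → ‖x - S.Gx *ᵥ v‖ < η →
      S.IsProjection r v := by
  obtain ⟨η, hη, h_close⟩ := hS.exists_mem_T_of_close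
  refine ⟨η, hη, fun r x v hv hx => ⟨hv.1.1, ?_⟩⟩
  have h_cont : Continuous fun w => ‖x - S.Gx *ᵥ w‖ := by
    have := (mulVecCLM S.Gx).continuous
    exact (continuous_const.sub this).norm
  have h_local : IsLocalMinOn (fun w => nsq (w - r)) S.Reps v := by
    filter_upwards [self_mem_nhdsWithin,
      nhdsWithin_le_nhds (h_cont.continuousAt.eventually_lt_const hx)] with w hw hw_close
    exact hv.2 w hw (S.mem_Γ_of_mem_T (h_close w hw x hw_close.le))
  exact fun w hw => IsMinOn.of_isLocalMinOn_of_convexOn hv.1.1 h_local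
    ((strictConvexOn_nsq_sub r).convexOn.subset (subset_univ _) hS.isPolyhedral_Reps.convex) hw

end StandingAssumptions

end Data

/-! ### Trajectories of the closed loop -/

theorem exists_isTrajectory_of_forall_exists {α : Type*} {step : α → α → Prop} {s : Set α}
    (h : ∀ a ∈ s, ∃ b ∈ s, step a b) {a : α} (ha : a ∈ s) :
    ∃ p, IsTrajectory step p ∧ p 0 = a := by
  choose f hf_mem hf using fun a : s => h a a.2
  let next : s → s := fun a => ⟨f a, hf_mem a⟩
  refine ⟨fun k => (next^[k] ⟨a, ha⟩).1, fun k => ?_, rfl⟩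
  simp only [Function.iterate_succ_apply']
  exact hf _

theorem tendsto_zero_of_decrease {Ψ V : ℕ → ℝ} {c : ℝ} (hc : 0 < c) (hΨ : ∀ k, 0 ≤ Ψ k)
    (hV : ∀ k, 0 ≤ V k) (h : ∀ k, Ψ (k + 1) ≤ Ψ k - c * V k) : Tendsto V atTop (𝓝 0) := by
  have h_anti : Antitone Ψ := antitone_nat_of_succ_le fun k =>
    (h k).trans (sub_le_self _ (mul_nonneg hc.le (hV k)))
  have h_lim := tendsto_atTop_ciInf h_anti ⟨0, forall_mem_range.2 hΨ⟩
  have h_diff : Tendsto (fun k => c⁻¹ * (Ψ k - Ψ (k + 1))) atTop (𝓝 0) := by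
    simpa using (h_lim.sub ((tendsto_add_atTop_iff_nat 1).2 h_lim)).const_mul c⁻¹
  refine squeeze_zero hV (fun k => ?_) h_diff
  rw [le_inv_mul_iff₀ hc]
  linarith [h k]

namespace Data

variable {nx nu ny nz nc : ℕ} {S : Data nx nu ny nz nc} {r rs : Fin nz → ℝ}

theorem mem_Γ_of_closedLoop {p q : (Fin nx → ℝ) × (Fin nz → ℝ)} (h : S.ClosedLoop r p q) :
    q ∈ S.Γ := by
  obtain ⟨-, μ, hμ, hq⟩ := h
  refine ⟨S.shiftInputs p.1 q.2 μ, ?_⟩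
  rw [hq]
  exact S.ocpFeasible_shiftInputs hμ.1

namespace StandingAssumptions

theorem exists_closedLoop (hS : S.StandingAssumptions) (r : Fin nz → ℝ)
    {p : (Fin nx → ℝ) × (Fin nz → ℝ)} (hp : ∃ v, (p.1, v) ∈ S.Γ) : ∃ q, S.ClosedLoop r p q := by
  obtain ⟨v, hv, -⟩ := hS.existsUnique_isGovernorOutput r hp
  obtain ⟨μ, hμ, -⟩ := hS.existsUnique_isOCPMinimizer hv.1.2
  exact ⟨(_, v), hv, μ, hμ, rfl⟩

theorem exists_isTrajectory (hS : S.StandingAssumptions) (r : Fin nz → ℝ)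
    {a : (Fin nx → ℝ) × (Fin nz → ℝ)} (ha : ∃ v, (a.1, v) ∈ S.Γ) :
    ∃ p, IsTrajectory (S.ClosedLoop r) p ∧ p 0 = a := by
  refine exists_isTrajectory_of_forall_exists
    (s := {a : (Fin nx → ℝ) × (Fin nz → ℝ) | ∃ v, (a.1, v) ∈ S.Γ}) (fun b hb => ?_) ha
  obtain ⟨q, hq⟩ := hS.exists_closedLoop r hb
  exact ⟨q, ⟨q.2, mem_Γ_of_closedLoop hq⟩, hq⟩

/- Along a trajectory the previous reference stays feasible, so the squared moves of the reference
are controlled by the decrease of its squared distance to `r`, which can be added to the Lyapunov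
function. -/
theorem tendsto_norm_tracking_error (hS : S.StandingAssumptions)
    {p : ℕ → (Fin nx → ℝ) × (Fin nz → ℝ)} (hp : IsTrajectory (S.ClosedLoop r) p) :
    Tendsto (fun k => ‖(p k).1 - S.Gx *ᵥ (p (k + 1)).2‖) atTop (𝓝 0) := by
  obtain ⟨V, ρ, D, hρ, hD, hV_lower, hV_next⟩ := hS.exists_lyapunov
  choose h_gov μ hμ h_next using hp
  let v (k : ℕ) : Fin nz → ℝ := (p (k + 1)).2
  let W (k : ℕ) : ℝ := V (((p k).1, v k), μ k)
  have hW_nonneg (k : ℕ) : 0 ≤ W k := (sq_nonneg _).trans (hV_lower _ _ _)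
  have hW_next (k : ℕ) : W (k + 1) ≤ ρ * W k + D * nsq (v (k + 1) - v k) := by
    have h_state : (p (k + 1)).1 = S.nextState (p k).1 (μ k) := h_next k
    have h := hV_next _ _ _ (v (k + 1)) (μ (k + 1)) (hμ k) (h_state ▸ hμ (k + 1))
    rwa [← h_state] at h
  have h_move (k : ℕ) : nsq (v (k + 1) - v k) ≤ 2 * (nsq (v k - r) - nsq (v (k + 1) - r)) :=
    hS.nsq_sub_le_of_isGovernorOutput (h_gov (k + 1))
      (mem_Γ_of_closedLoop ⟨h_gov k, μ k, hμ k, h_next k⟩)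
  have hW_lim : Tendsto W atTop (𝓝 0) := by
    refine tendsto_zero_of_decrease (Ψ := fun k => W k + D * (2 * nsq (v k - r)))
      (sub_pos.2 hρ) (fun k => ?_) hW_nonneg fun k => ?_
    · have := nsq_nonneg (v k - r)
      have := hW_nonneg k
      positivity
    · linarith [hW_next k, mul_le_mul_of_nonneg_left (h_move k) hD]
  have h_sq : Tendsto (fun k => ‖(p k).1 - S.Gx *ᵥ v k‖ ^ 2) atTop (𝓝 0) :=
    squeeze_zero (fun k => sq_nonneg _) (fun k => hV_lower _ _ _) hW_lim
  simpa [Real.sqrt_sq] using h_sq.sqrt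

theorem tendsto_of_isTrajectory (hS : S.StandingAssumptions) (hrs : S.IsProjection r rs)
    {p : ℕ → (Fin nx → ℝ) × (Fin nz → ℝ)} (hp : IsTrajectory (S.ClosedLoop r) p) :
    Tendsto p atTop (𝓝 (S.Gx *ᵥ rs, rs)) := by
  obtain ⟨η, hη, h_projection⟩ := hS.exists_isProjection_of_isGovernorOutput
  have h_err := hS.tendsto_norm_tracking_error hp
  have h_ref : ∀ᶠ k in atTop, (p (k + 1)).2 = rs := by
    filter_upwards [h_err.eventually_lt_const hη] with k hk
    exact (hS.existsUnique_isProjection r).unique (h_projection r _ _ (hp k).1 hk) hrs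
  have hv_lim : Tendsto (fun k => (p (k + 1)).2) atTop (𝓝 rs) :=
    tendsto_const_nhds.congr' (h_ref.mono fun _ hk => hk.symm)
  have hx_lim : Tendsto (fun k => (p k).1) atTop (𝓝 (S.Gx *ᵥ rs)) := by
    rw [tendsto_iff_norm_sub_tendsto_zero]
    exact h_err.congr' (h_ref.mono fun k hk => by rw [hk])
  rw [← tendsto_add_atTop_iff_nat 1]
  exact ((tendsto_add_atTop_iff_nat 1).2 hx_lim).prodMk_nhds hv_lim

theorem domainOfAttraction_eq (hS : S.StandingAssumptions) (hrs : S.IsProjection r rs) :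
    domainOfAttraction (S.ClosedLoop r) (S.Gx *ᵥ rs, rs) = (Prod.fst '' S.Λ) ×ˢ univ := by
  rw [fst_image_Λ]
  ext a
  simp only [mem_prod, mem_univ, and_true, mem_ofPred_eq]
  constructor
  · rintro ⟨⟨p, hp, rfl⟩, -⟩
    exact ⟨_, (hp 0).1.1.2⟩
  · exact fun ha => ⟨hS.exists_isTrajectory r ha, fun p hp _ => hS.tendsto_of_isTrajectory hrs hp⟩

/-! ### Local behaviour at the equilibrium -/

theorem eq_termInput_of_isOCPMinimizer_of_mem_T (hS : S.StandingAssumptions) {x : Fin nx → ℝ}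
    {v : Fin nz → ℝ} {μ : Fin S.N → Fin nu → ℝ} (hμ : S.IsOCPMinimizer x v μ)
    (hxv : (x, v) ∈ S.T) : μ ⟨0, S.N_pos⟩ = S.termInput v x := by
  have h_cost : S.deviationCost ((x, v), μ) = 0 :=
    le_antisymm ((hS.deviationCost_le_of_isOCPMinimizer hμ (S.ocpFeasible_termInputs hxv)).trans
      (S.deviationCost_termInputs v x).le) (hS.deviationCost_nonneg _)
  have h_summand : wsq S.lqrWeight (S.lqrDeviation ⟨0, S.N_pos⟩ ((x, v), μ)) = 0 :=
    (Finset.sum_eq_zero_iff_of_nonneg fun i _ =>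
      wsq_nonneg hS.lqrWeight_posDef.posSemidef _).1 h_cost _ (Finset.mem_univ _)
  have h_deviation := eq_zero_of_wsq_eq_zero hS.lqrWeight_posDef h_summand
  rw [lqrDeviation_apply] at h_deviation
  exact sub_eq_zero.1 h_deviation

theorem closedLoop_iff_of_mem_T (hS : S.StandingAssumptions) (hrs : S.IsProjection r rs)
    {p q : (Fin nx → ℝ) × (Fin nz → ℝ)} (hT : (p.1, rs) ∈ S.T) :
    S.ClosedLoop r p q ↔ q = (S.termStep rs p.1, rs) := by
  have h_unique {q : (Fin nx → ℝ) × (Fin nz → ℝ)} (h : S.ClosedLoop r p q) :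
      q = (S.termStep rs p.1, rs) := by
    obtain ⟨h_gov, μ, hμ, hq⟩ := h
    have h_ref : q.2 = rs := hS.eq_of_isGovernorOutput_of_mem_Γ hrs h_gov (S.mem_Γ_of_mem_T hT)
    rw [h_ref] at hμ
    refine Prod.ext ?_ h_ref
    rw [hq, hS.eq_termInput_of_isOCPMinimizer_of_mem_T hμ hT, termStep_eq]
  refine ⟨h_unique, ?_⟩
  rintro rfl
  obtain ⟨q, hq⟩ := hS.exists_closedLoop r (p := p) ⟨rs, S.mem_Γ_of_mem_T hT⟩
  exact h_unique hq ▸ hq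

theorem isEquilibrium (hS : S.StandingAssumptions) (hrs : S.IsProjection r rs) :
    IsEquilibrium (S.ClosedLoop r) (S.Gx *ᵥ rs, rs) := by
  have h_fixed : S.termStep rs (S.Gx *ᵥ rs) = S.Gx *ᵥ rs := by
    rw [← sub_eq_zero, hS.termStep_sub, sub_self, mulVec_zero]
  intro q
  rw [hS.closedLoop_iff_of_mem_T hrs (p := (S.Gx *ᵥ rs, rs)) (hS.steadyState_mem_T hrs.1),
    h_fixed]

theorem eq_iterate_of_isTrajectory (hS : S.StandingAssumptions) (hrs : S.IsProjection r rs)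
    {p : ℕ → (Fin nx → ℝ) × (Fin nz → ℝ)} (hp : IsTrajectory (S.ClosedLoop r) p)
    (hT : ((p 0).1, rs) ∈ S.T) (k : ℕ) :
    p (k + 1) = ((S.termStep rs)^[k + 1] (p 0).1, rs) := by
  induction k with
  | zero => exact (hS.closedLoop_iff_of_mem_T hrs hT).1 (hp 0)
  | succ k ih =>
    have h_step := (hS.closedLoop_iff_of_mem_T hrs
      (by rw [ih]; exact S.iterate_termStep_mem_T hT _)).1 (hp (k + 1))
    rw [h_step, ih, ← Function.iterate_succ_apply' (S.termStep rs)]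

theorem eventually_mem_T (hS : S.StandingAssumptions) {v : Fin nz → ℝ} (hv : v ∈ S.Reps) :
    ∀ᶠ a : (Fin nx → ℝ) × (Fin nz → ℝ) in 𝓝 (S.Gx *ᵥ v, v), (a.1, v) ∈ S.T := by
  obtain ⟨η, hη, h_close⟩ := hS.exists_mem_T_of_close
  filter_upwards [Metric.closedBall_mem_nhds _ hη] with a ha
  exact h_close v hv _ (dist_eq_norm a.1 _ ▸ (le_max_left _ _).trans ha)

theorem exists_norm_iterate_termStep_sub_le (hS : S.StandingAssumptions) :
    ∃ C : ℝ, 0 < C ∧ ∀ v x k,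
      ‖(S.termStep v)^[k] x - S.Gx *ᵥ v‖ ≤ C * ‖x - S.Gx *ᵥ v‖ := by
  obtain ⟨c, C, hc0, hc1, hC, h_decay⟩ := hS.isSchur_closedMatrix.exists_geometric_decay
  refine ⟨C, hC, fun v x k => ?_⟩
  rw [hS.iterate_termStep_sub]
  refine (h_decay k _).trans ?_
  gcongr
  exact mul_le_of_le_one_right hC.le (pow_le_one₀ hc0.le hc1.le)

theorem isLyapunovStable (hS : S.StandingAssumptions) (hrs : S.IsProjection r rs) :
    IsLyapunovStable (S.ClosedLoop r) (S.Gx *ᵥ rs, rs) := by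
  intro U hU
  obtain ⟨δ, hδ, h_ball⟩ := Metric.mem_nhds_iff.1 hU
  obtain ⟨C, hC, h_bound⟩ := hS.exists_norm_iterate_termStep_sub_le
  refine ⟨_, inter_mem (inter_mem hU (hS.eventually_mem_T hrs.1))
    (Metric.ball_mem_nhds (S.Gx *ᵥ rs, rs) (div_pos hδ hC)), ?_⟩
  rintro a ⟨⟨haU, haT⟩, ha⟩
  refine ⟨hS.exists_isTrajectory r ⟨rs, S.mem_Γ_of_mem_T haT⟩, ?_⟩
  rintro p hp rfl (_ | k)
  · exact haU
  refine h_ball ?_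
  rw [hS.eq_iterate_of_isTrajectory hrs hp haT, Metric.mem_ball, Prod.dist_eq, dist_self,
    max_lt_iff, dist_eq_norm]
  have h_lt : ‖(p 0).1 - S.Gx *ᵥ rs‖ < δ / C :=
    dist_eq_norm (p 0).1 _ ▸ (le_max_left _ _).trans_lt ha
  exact ⟨(h_bound _ _ _).trans_lt ((lt_div_iff₀' hC).1 h_lt), hδ⟩

theorem isAsymptoticallyStable (hS : S.StandingAssumptions) (hrs : S.IsProjection r rs) :
    IsAsymptoticallyStable (S.ClosedLoop r) (S.Gx *ᵥ rs, rs) := by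
  refine ⟨hS.isEquilibrium hrs, hS.isLyapunovStable hrs, ?_⟩
  rw [hS.domainOfAttraction_eq hrs, fst_image_Λ]
  filter_upwards [hS.eventually_mem_T hrs.1] with a ha
  exact ⟨⟨rs, S.mem_Γ_of_mem_T ha⟩, mem_univ _⟩

end StandingAssumptions

end Data

end FeasGov

theorem theorem3_general {nx nu ny nz nc : ℕ} (S : FeasGov.Data nx nu ny nz nc) (r : Fin nz → ℝ)
    (hε : S.ε ∈ Set.Ioo (0 : ℝ) 1)
    (hEq : S.A * S.Gx + S.B * S.Gu = S.Gx)
    (hYcompact : IsCompact S.Y) (hYint : (0 : Fin ny → ℝ) ∈ interior S.Y)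
    (hQ : S.Q.PosSemidef) (hDet : FeasGov.Detectable S.A S.Q) (hR : S.R.PosDef)
    (hP : S.IsRiccatiSolution) :
    (∀ x v, (x, v) ∈ S.Γ → ∃! μ, S.IsOCPMinimizer x v μ) ∧
    (∀ x ∈ Prod.fst '' S.Λ, ∃! v, S.IsGovernorOutput r x v) ∧
    ∃ rs : Fin nz → ℝ, (∀ v, S.IsProjection r v ↔ v = rs) ∧
      FeasGov.IsAsymptoticallyStable (S.ClosedLoop r) (S.Gx *ᵥ rs, rs) ∧
      FeasGov.domainOfAttraction (S.ClosedLoop r) (S.Gx *ᵥ rs, rs) =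
        (Prod.fst '' S.Λ) ×ˢ Set.univ := by
  have hS : S.StandingAssumptions :=
    { equilibrium := hEq, Q_posSemidef := hQ, R_posDef := hR, detectable := hDet, riccati := hP,
      eps_mem := hε, isCompact_Y := hYcompact, zero_mem_interior_Y := hYint }
  refine ⟨fun x v hxv => hS.existsUnique_isOCPMinimizer hxv, fun x hx => ?_, ?_⟩
  · rw [S.fst_image_Λ] at hx
    exact hS.existsUnique_isGovernorOutput r hx
  · obtain ⟨rs, hrs, h_unique⟩ := hS.existsUnique_isProjection r
    exact ⟨rs, fun v => ⟨h_unique v, fun hv => hv ▸ hrs⟩, hS.isAsymptoticallyStable hrs,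
      hS.domainOfAttraction_eq hrs⟩

theorem theorem3 {nx nu ny nz nc : ℕ} (S : FeasGov.Data nx nu ny nz nc) (r : Fin nz → ℝ)
    (hε : S.ε ∈ Set.Ioo (0 : ℝ) 1)
    (hG : S.IsEquilibriumBasis)
    (hStab : FeasGov.Stabilizable S.A S.B)
    (hGz : IsUnit S.Gz)
    (hYcompact : IsCompact S.Y) (hYint : (0 : Fin ny → ℝ) ∈ interior S.Y)
    (hQ : S.Q.PosSemidef) (hDet : FeasGov.Detectable S.A S.Q) (hR : S.R.PosDef)
    (hP : S.IsRiccatiSolution) :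
    (∀ x v, (x, v) ∈ S.Γ → ∃! μ, S.IsOCPMinimizer x v μ) ∧
    (∀ x ∈ Prod.fst '' S.Λ, ∃! v, S.IsGovernorOutput r x v) ∧
    ∃ rs : Fin nz → ℝ, (∀ v, S.IsProjection r v ↔ v = rs) ∧
      FeasGov.IsAsymptoticallyStable (S.ClosedLoop r) (S.Gx *ᵥ rs, rs) ∧
      FeasGov.domainOfAttraction (S.ClosedLoop r) (S.Gx *ᵥ rs, rs) =
        (Prod.fst '' S.Λ) ×ˢ Set.univ :=
  theorem3_general S r hε hG.mul_add_mul_eq hYcompact hYint hQ hDet hR hP
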